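/- Let $n\ge 1$. For $\eta>0$ let $$f_n(\eta)=\eta^{1-n}\int_0^\infty e^{-s^4}(\eta s)^{n/2}J_{(n-2)/2}(\eta s)\,ds,$$ where $J_\nu(y)=\sum_{k\ge0}\frac{(-1)^k(y/2)^{2k+\nu}}{k!\,\Gamma(k+\nu+1)}$ is the Bessel function, and let $\alpha_n^{-1}=\int_{\mathbb{R}^n}f_n(|x|)\,dx$. The solution of the Cauchy problem $$u_t+\Delta^2u=0\ \text{ in }\mathbb{R}^n\times(0,\infty),\qquad u(\cdot,0)=u_0\ \text{ in }\mathbb{R}^n,$$ is understood to be the function given by the biharmonic heat kernel, $$u(x,t)=\alpha_n t^{-n/4}\int_{\mathbb{R}^n}u_0(x-y)\,f_n\!\left(\frac{|y|}{t^{1/4}}\right)dy\qquad(x\in\mathbb{R}^n,\ t>0).$$ (i) Let $u_0:\mathbb{R}^n\to\mathbb{R}$ satisfy $u_0>0$ a.e. and $(1+|x|^4)\,u_0\in L^1(\mathbb{R}^n)$. Then $u$ is a solution of the Cauchy problem and changes sign: there is $T>0$ such that for every $t>T$ the function $u(\cdot,t)$ takes both strictly positive and strictly negative values. (ii) Let $n=1$.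 There exists $\beta_0>0$ such that for every $\beta\in(0,\beta_0)$ and $u_0(x)=|x|^{-\beta}$, the function $u$ is a solution of the Cauchy problem and $u>0$ a.e. in $\mathbb{R}\times(0,\infty)$. Here "$u$ is a solution of the Cauchy problem" means: $u$ is continuous on $\mathbb{R}^n\times(0,\infty)$, $u(\cdot,t)\in C^4(\mathbb{R}^n)$ for every $t>0$, $u_t$ exists and $u_t+\Delta^2u=0$ at every point of $\mathbb{R}^n\times(0,\infty)$, and $u(\cdot,t)\to u_0$ in $L^1_{\rm loc}(\mathbb{R}^n)$ as $t\to0^+$. -/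

import Mathlib

open MeasureTheory Filter Topology

namespace BiharmonicHeat

/-- Euclidean space `ℝⁿ`. -/
abbrev Space (n : ℕ) : Type := EuclideanSpace ℝ (Fin n)

/-- The Bessel function of the first kind
`J_ν(y) = ∑ₖ (-1)ᵏ (y/2)^(2k+ν) / (k! Γ(k+ν+1))`, for `ν > -1` and `y > 0`. -/
noncomputable def besselJ (ν y : ℝ) : ℝ :=
  ∑' k : ℕ, (-1 : ℝ) ^ k * (y / 2) ^ (2 * (k : ℝ) + ν) /
    ((k.factorial : ℝ) * Real.Gamma ((k : ℝ) + ν + 1))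

/-- The radial profile
`f_n(η) = η^(1-n) ∫₀^∞ e^{-s⁴} (ηs)^{n/2} J_{(n-2)/2}(ηs) ds`, for `n ≥ 1` and `η > 0`.
The value at `η = 0` is irrelevant: it only enters integrals over `ℝⁿ`, at a single point. -/
noncomputable def profile (n : ℕ) (η : ℝ) : ℝ :=
  η ^ (1 - (n : ℝ)) *
    ∫ s in Set.Ioi (0 : ℝ),
      Real.exp (-s ^ 4) * (η * s) ^ ((n : ℝ) / 2) * besselJ (((n : ℝ) - 2) / 2) (η * s)

/-- The normalization constant, `α_n⁻¹ = ∫_{ℝⁿ} f_n(|x|) dx`. -/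
noncomputable def normConst (n : ℕ) : ℝ :=
  (∫ x : Space n, profile n ‖x‖)⁻¹

/-- The solution of `u_t + Δ²u = 0`, `u(·,0) = u₀`, given by the biharmonic heat kernel:
`u(x,t) = α_n t^{-n/4} ∫_{ℝⁿ} u₀(x-y) f_n(|y| / t^{1/4}) dy`, for `t > 0`. -/
noncomputable def solution (n : ℕ) (u₀ : Space n → ℝ) (x : Space n) (t : ℝ) : ℝ :=
  normConst n * t ^ (-(n : ℝ) / 4) *
    ∫ y : Space n, u₀ (x - y) * profile n (‖y‖ / t ^ (1 / 4 : ℝ))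

/-- The bi-Laplacian `Δ²g = Δ(Δg)`. -/
noncomputable def bilaplacian {n : ℕ} (g : Space n → ℝ) : Space n → ℝ :=
  Laplacian.laplacian (Laplacian.laplacian g : Space n → ℝ)

/-- `u` is a classical solution of `u_t + Δ²u = 0` in `ℝⁿ × (0,∞)`, with initial datum `u₀`
attained in `L¹_loc(ℝⁿ)`. -/
structure SolvesCauchy {n : ℕ} (u₀ : Space n → ℝ) (u : Space n → ℝ → ℝ) : Prop where
  continuousOn : ContinuousOn (fun p : Space n × ℝ => u p.1 p.2) {p | 0 < p.2}
  contDiff : ∀ t : ℝ, 0 < t → ContDiff ℝ 4 (fun x => u x t)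
  equation : ∀ (x : Space n) (t : ℝ), 0 < t →
    HasDerivAt (fun s => u x s) (-bilaplacian (fun z => u z t) x) t
  initial : ∀ K : Set (Space n), IsCompact K →
    Tendsto (fun t : ℝ => ∫⁻ x in K, ‖u x t - u₀ x‖ₑ) (𝓝[>] 0) (𝓝 0)

end BiharmonicHeat

/-! Let K be the inverse Fourier transform of exp(-(2π|ξ|)⁴). It is a Schwartz function of integral
1, and t^(-n/4) K(t^(-1/4) x) solves the equation because ∂ₜ and Δ² multiply its Fourier transform
by opposite factors. Convolution with this kernel (`evolution`) therefore makes sense, and may be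
differentiated under the integral, for every datum integrable against some (1 + |y|)^(-m). This
class covers both parts of the theorem, and the initial datum is attained by L¹-continuity of
translations (`WeightedIntegrable.solvesCauchy_evolution`).

The profile f_n is a nonzero multiple of K: in polar coordinates K becomes an integral of spherical
averages of cosines, whose power series is that of the Bessel function (`exists_profile_eq`). The
multiple cancels against the normalization α_n, so `solution` and `evolution` agree.

For (i), the symbol has no quadratic term at 0, so the second moments of K vanish; since K(0) > 0, K
must be negative somewhere (`exists_kernel_neg`). As t → ∞, t^(n/4) u(t^(1/4) z, t) tends to (∫ u₀)
K(z), which has either sign for suitable z.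

For (ii), |x|^(-β) is close to 1 for small β, and the evolution of 1 is 1. Homogeneity reduces
positivity to t = 1, and a further dilation by max(1, |x|) makes the error O(β) uniformly in x
(`exists_integral_norm_rpow_mul_kernel_pos`). -/

namespace BiharmonicHeat

open scoped FourierTransform SchwartzMap ContDiff LineDeriv Laplacian

/-! ### Quartic exponentials are Schwartz functions -/

section Schwartz

variable {V : Type} [NormedAddCommGroup V] [InnerProductSpace ℝ V]

/-- A single term of the exponential series at c(2 + r⁴) dominates the power, because 1 + r ≤ 2 +
r⁴; the shift by 2 costs the factor exp(2c). -/
lemma one_add_pow_mul_exp_neg_le (M : ℕ) {c r : ℝ} (hc : 0 < c) (hr : 0 ≤ r) :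
    (1 + r) ^ M * Real.exp (-(c * r ^ 4)) ≤ M.factorial * (c⁻¹) ^ M * Real.exp (2 * c) := by
  have h1 : 1 + r ≤ c⁻¹ * (c * (2 + r ^ 4)) := by
    rw [inv_mul_cancel_left₀ hc.ne']
    nlinarith [sq_nonneg (r ^ 2 - 1), sq_nonneg (r - 1), sq_nonneg (r^2)]
  have h2 := Real.pow_div_factorial_le_exp (c * (2 + r ^ 4)) (by positivity) M
  rw [div_le_iff₀ (by positivity)] at h2
  calc (1 + r) ^ M * Real.exp (-(c * r ^ 4))
      ≤ (c⁻¹ * (c * (2 + r ^ 4))) ^ M * Real.exp (-(c * r ^ 4)) := by gcongr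
    _ = (c⁻¹) ^ M * (c * (2 + r ^ 4)) ^ M * Real.exp (-(c * r ^ 4)) := by rw [mul_pow]
    _ ≤ (c⁻¹) ^ M * (Real.exp (c * (2 + r ^ 4)) * M.factorial) * Real.exp (-(c * r ^ 4)) := by
        gcongr
    _ = M.factorial * (c⁻¹) ^ M * (Real.exp (c * (2 + r ^ 4)) * Real.exp (-(c * r ^ 4))) := by ring
    _ = _ := by rw [← Real.exp_add]; congr 2; ring

lemma contDiff_exp_neg_quartic (c : ℝ) :
    ContDiff ℝ ∞ (fun x : V => Real.exp (-(c * (‖x‖ ^ 2) ^ 2))) := by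
  have : ContDiff ℝ ∞ (fun x : V => ‖x‖ ^ 2) := contDiff_norm_sq ℝ
  fun_prop

lemma hasFDerivAt_exp_neg_quartic (c : ℝ) (x : V) :
    HasFDerivAt (fun x : V => Real.exp (-(c * (‖x‖ ^ 2) ^ 2)))
      (Real.exp (-(c * (‖x‖ ^ 2) ^ 2)) • ((-(4 * c * ‖x‖ ^ 2)) • innerSL ℝ x)) x := by
  have h := (((hasStrictFDerivAt_norm_sq x).hasFDerivAt.pow 2).const_mul c).neg.exp
  convert! h using 2
  ext v
  simp
  ring

/-- The derivative of exp(-c|x|⁴) p is exp(-c|x|⁴) q, where q again has temperate growth but takes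
values in V →L F. The induction on the order therefore has to range over all target spaces and all
p; the case of interest is p = 1. -/
lemma exists_bound_iteratedFDeriv_exp_neg_quartic {c : ℝ} (hc : 0 < c) (j : ℕ) :
    ∀ {F : Type} [NormedAddCommGroup F] [NormedSpace ℝ F] (p : V → F), p.HasTemperateGrowth →
      ∀ k : ℕ, ∃ C, ∀ x, ‖x‖ ^ k *
        ‖iteratedFDeriv ℝ j (fun x => Real.exp (-(c * (‖x‖ ^ 2) ^ 2)) • p x) x‖ ≤ C := by
  induction j with
  | zero =>
    intro F _ _ p hp k
    obtain ⟨N, C, hC, h⟩ := hp.norm_iteratedFDeriv_le_uniform 0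
    refine ⟨C * ((k + N).factorial * (c⁻¹) ^ (k + N) * Real.exp (2 * c)), fun x => ?_⟩
    have h0 := h 0 le_rfl x
    rw [norm_iteratedFDeriv_zero] at h0 ⊢
    rw [norm_smul, Real.norm_of_nonneg (Real.exp_nonneg _)]
    have h1 : ‖x‖ ≤ 1 + ‖x‖ := by linarith
    calc ‖x‖ ^ k * (Real.exp (-(c * (‖x‖ ^ 2) ^ 2)) * ‖p x‖)
        ≤ (1 + ‖x‖) ^ k * (Real.exp (-(c * (‖x‖ ^ 2) ^ 2)) * (C * (1 + ‖x‖) ^ N)) := by gcongr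
      _ = C * ((1 + ‖x‖) ^ (k + N) * Real.exp (-(c * ‖x‖ ^ 4))) := by
          rw [← pow_mul, pow_add]; ring
      _ ≤ _ := mul_le_mul_of_nonneg_left (one_add_pow_mul_exp_neg_le _ hc (norm_nonneg x)) hC
  | succ j ih =>
    intro F _ _ p hp k
    have hfd : (fderiv ℝ p).HasTemperateGrowth := by
      refine ⟨hp.1.fderiv_right (by simp), fun m => ?_⟩
      obtain ⟨k, C, h⟩ := hp.2 (m + 1)
      exact ⟨k, C, fun x => by simpa [norm_iteratedFDeriv_fderiv] using h x⟩
    have hq : (fun x : V => fderiv ℝ p x + (-(4 * c * ‖x‖ ^ 2)) •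
        ContinuousLinearMap.smulRightL ℝ V F (innerSL ℝ x) (p x)).HasTemperateGrowth := by
      have h1 : (fun x : V => innerSL ℝ x).HasTemperateGrowth :=
        (innerSL ℝ (E := V)).hasTemperateGrowth
      have h2 := (ContinuousLinearMap.smulRightL ℝ V F).bilinear_hasTemperateGrowth h1 hp
      have h3 : (fun x : V => -(4 * c * ‖x‖ ^ 2)).HasTemperateGrowth := by fun_prop
      exact hfd.add (h3.smul h2)
    obtain ⟨C, h⟩ := ih _ hq k
    refine ⟨C, fun x => ?_⟩
    convert h x using 2
    rw [← norm_iteratedFDeriv_fderiv]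
    congr 2
    ext1 y
    have hy := (hasFDerivAt_exp_neg_quartic c y).smul
      ((hp.1.differentiable (by simp)).differentiableAt (x := y)).hasFDerivAt
    refine hy.fderiv.trans ?_
    ext v
    simp [smul_smul]

/-- The Schwartz function `x ↦ exp (-c‖x‖⁴)`, for `c > 0`. -/
noncomputable def expNegQuartic (V : Type) [NormedAddCommGroup V] [InnerProductSpace ℝ V] {c : ℝ}
    (hc : 0 < c) : 𝓢(V, ℝ) where
  toFun x := Real.exp (-(c * (‖x‖ ^ 2) ^ 2))
  smooth' := contDiff_exp_neg_quartic c
  decay' k j := by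
    simpa using exists_bound_iteratedFDeriv_exp_neg_quartic (V := V) hc j (fun _ => (1 : ℝ))
      (Function.HasTemperateGrowth.const 1) k

lemma expNegQuartic_apply {c : ℝ} (hc : 0 < c) (x : V) :
    expNegQuartic V hc x = Real.exp (-(c * (‖x‖ ^ 2) ^ 2)) := rfl

end Schwartz

end BiharmonicHeat

/-! ### The cosine transform, the kernel and its sign -/

namespace BiharmonicHeat

open scoped FourierTransform SchwartzMap ContDiff LineDeriv Laplacian

section CosineTransform

variable {V : Type} [NormedAddCommGroup V] [InnerProductSpace ℝ V] [FiniteDimensional ℝ V]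
  [MeasurableSpace V] [BorelSpace V]

/-- A real Schwartz function, viewed as complex valued. -/
noncomputable def complexify : 𝓢(V, ℝ) →L[ℝ] 𝓢(V, ℂ) :=
  SchwartzMap.postcompCLM Complex.ofRealCLM

/-- The cosine transform `x ↦ ∫ cos (2π⟪ξ, x⟫) f ξ dξ` of a real Schwartz function. -/
noncomputable def cosTransform (f : 𝓢(V, ℝ)) : 𝓢(V, ℝ) :=
  SchwartzMap.postcompCLM Complex.reCLM (𝓕⁻ (complexify f))

omit [FiniteDimensional ℝ V] [MeasurableSpace V] [BorelSpace V] in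
lemma complexify_apply (f : 𝓢(V, ℝ)) (x : V) : complexify f x = f x := rfl

lemma cosTransform_apply_eq_re (f : 𝓢(V, ℝ)) (x : V) :
    cosTransform f x = (𝓕⁻ (complexify f) x).re := rfl

lemma cosTransform_apply (f : 𝓢(V, ℝ)) (x : V) :
    cosTransform f x = ∫ ξ, Real.cos (2 * Real.pi * inner ℝ ξ x) * f ξ := by
  rw [cosTransform_apply_eq_re, SchwartzMap.fourierInv_coe, Real.fourierInv_eq',
    ← Complex.reCLM_apply, ← ContinuousLinearMap.integral_comp_comm]
  · congr 1
    ext ξ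
    rw [complexify_apply]
    simp [Complex.exp_ofReal_mul_I_re, -Complex.ofReal_mul]
  · have h : Integrable (complexify f) := (complexify f).integrable
    refine h.bdd_mul (c := 1) (by fun_prop) (Eventually.of_forall fun ξ => ?_)
    rw [Complex.norm_exp_ofReal_mul_I]

omit [MeasurableSpace V] [BorelSpace V] in
lemma laplacian_postcomp_re (g : 𝓢(V, ℂ)) :
    Δ (SchwartzMap.postcompCLM Complex.reCLM g) = SchwartzMap.postcompCLM Complex.reCLM (Δ g) := by
  ext x
  rw [SchwartzMap.laplacian_apply, SchwartzMap.postcompCLM_apply, SchwartzMap.laplacian_apply]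
  exact ((g.contDiffAt 2).laplacian_CLM_comp_left (l := Complex.reCLM))

lemma laplacian_cosTransform (f : 𝓢(V, ℝ)) :
    Δ (cosTransform f) =
      cosTransform (-(2 * Real.pi) ^ 2 • SchwartzMap.smulLeftCLM ℝ (fun ξ : V => ‖ξ‖ ^ 2) f) := by
  rw [cosTransform, laplacian_postcomp_re, SchwartzMap.laplacian_eq_fourierMultiplierCLM,
    SchwartzMap.fourierMultiplierCLM_apply, FourierTransform.fourier_fourierInv_eq, cosTransform,
    ← FourierTransform.fourierInv_smul]
  congr 2
  ext ξ
  have h : (fun ξ : V => ‖ξ‖ ^ 2).HasTemperateGrowth := by fun_prop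
  rw [complexify_apply]
  simp [h, complexify_apply]

lemma integral_fourierInv (g : 𝓢(V, ℂ)) : ∫ x, 𝓕⁻ g x = g 0 := by
  have h : 𝓕 (𝓕⁻ g) 0 = g 0 := by rw [FourierTransform.fourier_fourierInv_eq]
  rw [← h, SchwartzMap.fourier_coe, Real.fourier_eq']
  simp

lemma integral_cosTransform (f : 𝓢(V, ℝ)) : ∫ x, cosTransform f x = f 0 := by
  simp only [cosTransform_apply_eq_re]
  have h := ContinuousLinearMap.integral_comp_comm Complex.reCLM (𝓕⁻ (complexify f)).integrable
    (μ := volume)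
  simp only [Complex.reCLM_apply] at h
  rw [h, integral_fourierInv, complexify_apply, Complex.ofReal_re]

omit [FiniteDimensional ℝ V] [MeasurableSpace V] [BorelSpace V] in
lemma lineDeriv_complexify (f : 𝓢(V, ℝ)) (e : V) : ∂_{e} (complexify f) = complexify (∂_{e} f) := by
  ext x
  rw [complexify_apply, SchwartzMap.lineDerivOp_apply_eq_fderiv,
    SchwartzMap.lineDerivOp_apply_eq_fderiv]
  have h := (Complex.ofRealCLM.hasFDerivAt (x := f x)).comp x (f.hasFDerivAt x)
  have h2 : (Complex.ofRealCLM ∘ f : V → ℂ) = complexify f := rfl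
  rw [h2] at h
  rw [h.fderiv]
  rfl

/-- Under the inverse transform two derivatives of f become the factor -(2π)²⟪x, e⟫², and
integrating a transform evaluates the original function at 0. -/
lemma integral_inner_sq_mul_cosTransform (f : 𝓢(V, ℝ)) (e : V) :
    (2 * Real.pi) ^ 2 * ∫ x, inner ℝ x e ^ 2 * cosTransform f x = -(∂_{e} (∂_{e} f)) 0 := by
  rw [← integral_cosTransform, ← integral_const_mul, ← integral_neg]
  congr 1
  ext x
  have h : (fun x : V => inner ℝ x e).HasTemperateGrowth := by fun_prop
  rw [cosTransform_apply_eq_re, cosTransform_apply_eq_re, ← lineDeriv_complexify,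
    ← lineDeriv_complexify, SchwartzMap.fourierInv_lineDerivOp_eq,
    SchwartzMap.fourierInv_lineDerivOp_eq]
  simp [h]
  ring

end CosineTransform

/-- The Schwartz function `ξ ↦ exp (-(2π‖ξ‖)⁴)`. -/
noncomputable def heatSymbol (n : ℕ) : 𝓢(Space n, ℝ) :=
  expNegQuartic (Space n) (c := (2 * Real.pi) ^ 4) (by positivity)

lemma heatSymbol_apply {n : ℕ} (ξ : Space n) :
    heatSymbol n ξ = Real.exp (-((2 * Real.pi) ^ 4 * (‖ξ‖ ^ 2) ^ 2)) := rfl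

/-- The biharmonic heat kernel at time `1`. -/
noncomputable def kernel (n : ℕ) : 𝓢(Space n, ℝ) := cosTransform (heatSymbol n)

lemma integral_kernel (n : ℕ) : ∫ x, kernel n x = 1 := by
  rw [kernel, integral_cosTransform, heatSymbol_apply]
  simp

lemma kernel_zero_pos (n : ℕ) : 0 < kernel n 0 := by
  rw [kernel, cosTransform_apply, integral_pos_iff_support_of_nonneg]
  · have : (Function.support fun ξ : Space n =>
        Real.cos (2 * Real.pi * inner ℝ ξ 0) * heatSymbol n ξ) = Set.univ := by
      ext ξ
      simp [heatSymbol_apply]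
    rw [this, Measure.measure_univ_pos]
    exact NeZero.ne _
  · intro ξ
    simp [heatSymbol_apply, Real.exp_nonneg]
  · simpa using (heatSymbol n).integrable

/-- The symbol is 1 - (2π|ξ|)⁴ + ⋯, with no quadratic term: its derivative along e is O(t³) on the
line ℝe. -/
lemma lineDeriv_lineDeriv_heatSymbol_zero {n : ℕ} (e : Space n) :
    (∂_{e} (∂_{e} (heatSymbol n))) 0 = 0 := by
  have h1 : ∀ x, (∂_{e} (heatSymbol n)) x = Real.exp (-((2 * Real.pi) ^ 4 * (‖x‖ ^ 2) ^ 2)) *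
      (-(4 * (2 * Real.pi) ^ 4 * ‖x‖ ^ 2) * inner ℝ x e) := by
    intro x
    rw [SchwartzMap.lineDerivOp_apply_eq_fderiv]
    have := hasFDerivAt_exp_neg_quartic (V := Space n) ((2 * Real.pi) ^ 4) x
    have h2 : fderiv ℝ (heatSymbol n) x = _ := this.fderiv
    rw [h2]
    simp
  rw [SchwartzMap.lineDerivOp_apply, lineDeriv]
  have h3 : (fun t : ℝ => (∂_{e} (heatSymbol n)) (0 + t • e)) = fun t : ℝ => t ^ 3 *
      (Real.exp (-((2 * Real.pi) ^ 4 * (t ^ 2 * ‖e‖ ^ 2) ^ 2)) *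
      (-(4 * (2 * Real.pi) ^ 4 * ‖e‖ ^ 4))) := by
    ext t
    rw [h1, zero_add, norm_smul, Real.norm_eq_abs, mul_pow |t|, sq_abs, real_inner_smul_left,
      real_inner_self_eq_norm_sq]
    ring
  rw [h3, deriv_fun_mul (by fun_prop) (by fun_prop)]
  simp

/-- If K were nonnegative, its vanishing second moment in direction e would force ⟪x, e⟫² K(x) = 0
for all x. Then K vanishes off a hyperplane, hence at 0 by continuity, against K(0) > 0. -/
lemma exists_kernel_neg {n : ℕ} (hn : 1 ≤ n) : ∃ z, kernel n z < 0 := by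
  by_contra! h
  have : Nonempty (Fin n) := ⟨⟨0, hn⟩⟩
  let i : Fin n := Classical.arbitrary _
  let e : Space n := EuclideanSpace.single i 1
  have h1 := integral_inner_sq_mul_cosTransform (heatSymbol n) e
  rw [lineDeriv_lineDeriv_heatSymbol_zero, neg_zero, mul_eq_zero_iff_left (by positivity),
    show cosTransform (heatSymbol n) = kernel n from rfl,
    integral_eq_zero_iff_of_nonneg (fun x => mul_nonneg (sq_nonneg _) (h x))] at h1
  · have h2 : Continuous fun x : Space n => inner ℝ x e ^ 2 * kernel n x := by
      have := (kernel n).continuous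
      fun_prop
    have h3 := (h2.ae_eq_iff_eq volume continuous_const).1 h1
    have h4 : Tendsto (fun s : ℝ => kernel n (s • e)) (𝓝[≠] 0) (𝓝 (kernel n 0)) := by
      have : Continuous fun s : ℝ => kernel n (s • e) := by
        have := (kernel n).continuous
        fun_prop
      simpa using (this.tendsto 0).mono_left nhdsWithin_le_nhds
    have h5 : ∀ᶠ s : ℝ in 𝓝[≠] 0, kernel n (s • e) = 0 := by
      filter_upwards [self_mem_nhdsWithin] with s hs
      have h6 : inner ℝ (s • e) e ^ 2 * kernel n (s • e) = 0 := congrFun h3 (s • e)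
      have hs : s ≠ 0 := hs
      simpa [real_inner_smul_left, e, hs] using h6
    have h7 := tendsto_nhds_unique h4 (tendsto_const_nhds.congr' (h5.mono fun s hs => hs.symm))
    exact (kernel_zero_pos n).ne' h7
  · have hg : (fun x : Space n => inner ℝ x e ^ 2).HasTemperateGrowth := by fun_prop
    have := (SchwartzMap.smulLeftCLM ℝ (fun x : Space n => inner ℝ x e ^ 2)
      (kernel n)).integrable (μ := volume)
    simpa only [SchwartzMap.smulLeftCLM_apply hg, smul_eq_mul] using this

end BiharmonicHeat

/-! ### Scaling of the kernel and its time derivative -/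

namespace BiharmonicHeat

open scoped FourierTransform SchwartzMap ContDiff LineDeriv Laplacian

lemma pow_mul_cosTransform_smul {n : ℕ} (f : 𝓢(Space n, ℝ)) (x : Space n) {a : ℝ} (ha : 0 < a) :
    a ^ n * cosTransform f (a • x) =
      ∫ ξ, Real.cos (2 * Real.pi * inner ℝ ξ x) * f (a⁻¹ • ξ) := by
  have h := Measure.integral_comp_smul volume
    (fun ξ : Space n => Real.cos (2 * Real.pi * inner ℝ ξ (a • x)) * f ξ) a⁻¹
  rw [cosTransform_apply]
  have h2 : |((a⁻¹) ^ n)⁻¹| = a ^ n := by rw [inv_pow, inv_inv, abs_of_pos (by positivity)]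
  rw [finrank_euclideanSpace_fin, h2, smul_eq_mul] at h
  rw [← h]
  congr 1
  ext ξ
  rw [real_inner_smul_left, real_inner_smul_right, inv_mul_cancel_left₀ ha.ne']

/-- Each Laplacian multiplies the symbol by -(2π)²|ξ|². The product (2π|ξ|)⁴ is, up to sign, the
factor that ∂ₜ brings down from exp(-t(2π|ξ|)⁴). -/
lemma laplacian_laplacian_kernel {n : ℕ} :
    ∃ f : 𝓢(Space n, ℝ), Δ (Δ (kernel n)) = cosTransform f ∧
      ∀ ξ, f ξ = (2 * Real.pi) ^ 4 * (‖ξ‖ ^ 2) ^ 2 *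
        Real.exp (-((2 * Real.pi) ^ 4 * (‖ξ‖ ^ 2) ^ 2)) := by
  have h : (fun ξ : Space n => ‖ξ‖ ^ 2).HasTemperateGrowth := by fun_prop
  refine ⟨_, by rw [kernel, laplacian_cosTransform, laplacian_cosTransform], fun ξ => ?_⟩
  simp [h, heatSymbol_apply, -SchwartzMap.smulLeftCLM_smulLeftCLM_apply]
  ring

lemma integrable_quartic_mul_exp {n : ℕ} {c : ℝ} (hc : 0 < c) :
    Integrable fun ξ : Space n => (‖ξ‖ ^ 2) ^ 2 * Real.exp (-(c * (‖ξ‖ ^ 2) ^ 2)) := by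
  have h : (fun ξ : Space n => (‖ξ‖ ^ 2) ^ 2).HasTemperateGrowth := by fun_prop
  have := (SchwartzMap.smulLeftCLM ℝ (fun ξ : Space n => (‖ξ‖ ^ 2) ^ 2)
    (expNegQuartic (Space n) hc)).integrable (μ := volume)
  simpa only [SchwartzMap.smulLeftCLM_apply h, smul_eq_mul, expNegQuartic_apply] using this

/-- The length scale `t^(-1/4)`. -/
noncomputable def invScale (t : ℝ) : ℝ := t ^ (-(1 / 4) : ℝ)

lemma invScale_pos {t : ℝ} (ht : 0 < t) : 0 < invScale t := Real.rpow_pos_of_pos ht _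

lemma invScale_inv_pow_four {t : ℝ} (ht : 0 < t) : (invScale t)⁻¹ ^ 4 = t := by
  rw [invScale, ← Real.rpow_neg ht.le, ← Real.rpow_natCast, ← Real.rpow_mul ht.le]
  norm_num

/-- Dilating the frequency variable moves all the dependence on t into the exponential, where it can
be differentiated under the integral. -/
lemma pow_mul_kernel_eq {n : ℕ} (x : Space n) {t : ℝ} (ht : 0 < t) :
    invScale t ^ n * kernel n (invScale t • x) = ∫ ξ, Real.cos (2 * Real.pi * inner ℝ ξ x) *
      Real.exp (-(t * ((2 * Real.pi) ^ 4 * (‖ξ‖ ^ 2) ^ 2))) := by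
  rw [kernel, pow_mul_cosTransform_smul _ _ (invScale_pos ht)]
  congr 1
  ext ξ
  rw [heatSymbol_apply, norm_smul, Real.norm_of_nonneg (inv_nonneg.2 (invScale_pos ht).le)]
  congr 3
  nth_rewrite 2 [← invScale_inv_pow_four ht]
  ring

lemma pow_mul_bilaplacian_kernel_eq {n : ℕ} (x : Space n) {t : ℝ} (ht : 0 < t) :
    invScale t ^ (n + 4) * (Δ (Δ (kernel n))) (invScale t • x) =
      ∫ ξ, Real.cos (2 * Real.pi * inner ℝ ξ x) * ((2 * Real.pi) ^ 4 * (‖ξ‖ ^ 2) ^ 2 *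
        Real.exp (-(t * ((2 * Real.pi) ^ 4 * (‖ξ‖ ^ 2) ^ 2)))) := by
  obtain ⟨f, hf, hfa⟩ := laplacian_laplacian_kernel (n := n)
  have ha := invScale_pos ht
  rw [hf, add_comm, pow_add, mul_assoc, pow_mul_cosTransform_smul _ _ ha, ← integral_const_mul]
  congr 1
  ext ξ
  rw [hfa, norm_smul, Real.norm_of_nonneg (inv_nonneg.2 ha.le)]
  have h : (2 * Real.pi) ^ 4 * (((invScale t)⁻¹ * ‖ξ‖) ^ 2) ^ 2 =
      t * ((2 * Real.pi) ^ 4 * (‖ξ‖ ^ 2) ^ 2) := by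
    nth_rewrite 2 [← invScale_inv_pow_four ht]
    ring
  have h2 : invScale t ^ 4 * t = 1 := by
    nth_rewrite 2 [← invScale_inv_pow_four ht]
    rw [← mul_pow, mul_inv_cancel₀ ha.ne', one_pow]
  rw [h]
  linear_combination Real.cos (2 * Real.pi * inner ℝ ξ x) * ((2 * Real.pi) ^ 4 * (‖ξ‖ ^ 2) ^ 2 *
        Real.exp (-(t * ((2 * Real.pi) ^ 4 * (‖ξ‖ ^ 2) ^ 2)))) * h2

lemma hasDerivAt_scaled_kernel {n : ℕ} (x : Space n) {t : ℝ} (ht : 0 < t) :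
    HasDerivAt (fun s => invScale s ^ n * kernel n (invScale s • x))
      (-(invScale t ^ (n + 4) * (Δ (Δ (kernel n))) (invScale t • x))) t := by
  rw [pow_mul_bilaplacian_kernel_eq x ht, ← integral_neg]
  have hball : Metric.ball t (t / 2) ∈ 𝓝 t := Metric.ball_mem_nhds t (by positivity)
  have hpos : ∀ s ∈ Metric.ball t (t / 2), t / 2 < s := by
    intro s hs
    rw [Metric.mem_ball, Real.dist_eq, abs_lt] at hs
    linarith
  have key := hasDerivAt_integral_of_dominated_loc_of_deriv_le (μ := volume) (x₀ := t)
    (s := Metric.ball t (t / 2))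
    (F := fun s (ξ : Space n) => Real.cos (2 * Real.pi * inner ℝ ξ x) *
      Real.exp (-(s * ((2 * Real.pi) ^ 4 * (‖ξ‖ ^ 2) ^ 2))))
    (F' := fun s (ξ : Space n) => -(Real.cos (2 * Real.pi * inner ℝ ξ x) *
      ((2 * Real.pi) ^ 4 * (‖ξ‖ ^ 2) ^ 2 *
        Real.exp (-(s * ((2 * Real.pi) ^ 4 * (‖ξ‖ ^ 2) ^ 2))))))
    -- Every s in the ball exceeds t/2, so the exponential at time t/2 dominates.
    (bound := fun ξ => (2 * Real.pi) ^ 4 * ((‖ξ‖ ^ 2) ^ 2 *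
        Real.exp (-((t / 2 * (2 * Real.pi) ^ 4) * (‖ξ‖ ^ 2) ^ 2)))) hball ?_ ?_ ?_ ?_ ?_ ?_
  · refine key.2.congr_of_eventuallyEq ?_
    filter_upwards [lt_mem_nhds ht] with s hs using pow_mul_kernel_eq x hs
  · exact Eventually.of_forall fun s => by
      apply Continuous.aestronglyMeasurable
      fun_prop
  · have h := (expNegQuartic (Space n) (c := t * (2 * Real.pi) ^ 4) (by positivity)).integrable
      (μ := volume)
    refine (h.bdd_mul (c := 1) (f := fun ξ : Space n => Real.cos (2 * Real.pi * inner ℝ ξ x))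
      (Continuous.aestronglyMeasurable (by fun_prop))
      (Eventually.of_forall fun ξ => ?_)).congr (Eventually.of_forall fun ξ => ?_)
    · exact Real.abs_cos_le_one _
    · simp only [expNegQuartic_apply, mul_assoc]
  · apply Continuous.aestronglyMeasurable
    fun_prop
  · refine Eventually.of_forall fun ξ s hs => ?_
    rw [norm_neg, norm_mul, Real.norm_of_nonneg (r := _ * Real.exp _) (by positivity), mul_assoc,
      mul_assoc]
    refine (mul_le_of_le_one_left (by positivity) (Real.abs_cos_le_one _)).trans ?_
    have := (hpos s hs).le
    rw [mul_assoc (t / 2)]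
    gcongr
  · exact (integrable_quartic_mul_exp (by positivity)).const_mul _
  · refine Eventually.of_forall fun ξ s hs => ?_
    have h := (((hasDerivAt_id s).mul_const ((2 * Real.pi) ^ 4 * (‖ξ‖ ^ 2) ^ 2)).neg.exp).const_mul
      (Real.cos (2 * Real.pi * inner ℝ ξ x))
    convert! h using 1
    simp only [Pi.neg_apply, id]
    ring

end BiharmonicHeat

/-! ### Convolution of weighted integrable data with a dilated Schwartz function -/

namespace BiharmonicHeat

open scoped FourierTransform SchwartzMap ContDiff LineDeriv Laplacian

section ScaledConvolution

variable {V F : Type} [NormedAddCommGroup V] [InnerProductSpace ℝ V] [FiniteDimensional ℝ V]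
  [MeasurableSpace V] [BorelSpace V] [NormedAddCommGroup F] [NormedSpace ℝ F]

/-- Integrability against the polynomial weight `(1 + ‖y‖)^(-m)`. -/
def WeightedIntegrable (m : ℕ) (u₀ : V → ℝ) : Prop :=
  Integrable fun y => ((1 + ‖y‖) ^ m)⁻¹ * u₀ y

/-- The convolution `x ↦ ∫ u₀ y φ(a(x - y)) dy`. -/
noncomputable def scaledConv (u₀ : V → ℝ) (φ : 𝓢(V, F)) (a : ℝ) (x : V) : F :=
  ∫ y, u₀ y • φ (a • (x - y))

lemma WeightedIntegrable.aestronglyMeasurable {m : ℕ} {u₀ : V → ℝ}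
    (hu : WeightedIntegrable m u₀) : AEStronglyMeasurable u₀ volume := by
  have h : Continuous fun y : V => (1 + ‖y‖) ^ m := by fun_prop
  refine (h.aestronglyMeasurable.mul (Integrable.aestronglyMeasurable hu)).congr
    (Eventually.of_forall fun y => ?_)
  have : (1 + ‖y‖) ^ m ≠ 0 := by positivity
  simp only [Pi.mul_apply]
  field_simp

omit [FiniteDimensional ℝ V] [MeasurableSpace V] [BorelSpace V] in
lemma exists_one_add_pow_mul_norm_le (φ : 𝓢(V, F)) (m : ℕ) :
    ∃ C, 0 ≤ C ∧ ∀ z, (1 + ‖z‖) ^ m * ‖φ z‖ ≤ C := by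
  have h := SchwartzMap.one_add_le_sup_seminorm_apply (𝕜 := ℝ) (m := (m, 0)) le_rfl le_rfl φ
  simp only [norm_iteratedFDeriv_zero] at h
  exact ⟨_, (by positivity : 0 ≤ (1 + ‖(0 : V)‖) ^ m * ‖φ 0‖).trans (h 0), h⟩

omit [FiniteDimensional ℝ V] [MeasurableSpace V] [BorelSpace V] in
-- This domination serves every passage to the limit under the integral below. Decay of φ in a(x -
-- y) is traded for decay in y through 1 + |y| ≤ (1 + R)(1 + 1/a₀)(1 + |a(x - y)|), uniformly for
-- |x| ≤ R and a ≥ a₀.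
lemma exists_norm_smul_le (u₀ : V → ℝ) (φ : 𝓢(V, F)) (m : ℕ) (R : ℝ) {a₀ : ℝ} (ha₀ : 0 < a₀) :
    ∃ D, ∀ x, ‖x‖ ≤ R → ∀ a, a₀ ≤ a → ∀ y,
      ‖u₀ y • φ (a • (x - y))‖ ≤ D * ‖((1 + ‖y‖) ^ m)⁻¹ * u₀ y‖ := by
  obtain ⟨C, hC, h⟩ := exists_one_add_pow_mul_norm_le φ m
  refine ⟨((1 + R) * (1 + a₀⁻¹)) ^ m * C, fun x hx a ha y => ?_⟩
  have ha' : 0 < a := ha₀.trans_le ha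
  have hR : 0 ≤ R := (norm_nonneg x).trans hx
  have h1 : 1 + ‖y‖ ≤ (1 + R) * (1 + a₀⁻¹) * (1 + ‖a • (x - y)‖) := by
    rw [norm_smul, Real.norm_of_nonneg ha'.le]
    have h2 : ‖y‖ ≤ ‖x‖ + ‖x - y‖ := by
      simpa [norm_sub_rev] using norm_le_norm_add_norm_sub' y x
    have h3 : ‖x - y‖ ≤ a₀⁻¹ * (a * ‖x - y‖) := by
      rw [← mul_assoc]
      refine le_mul_of_one_le_left (norm_nonneg _) ?_
      rw [inv_mul_eq_div, one_le_div ha₀]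
      exact ha
    have h4 : 0 ≤ a * ‖x - y‖ := by positivity
    have h5 : 0 < a₀⁻¹ := by positivity
    calc 1 + ‖y‖ ≤ 1 + (R + a₀⁻¹ * (a * ‖x - y‖)) := by linarith
      _ ≤ (1 + R) * ((1 + a₀⁻¹) * (1 + a * ‖x - y‖)) := by
        have h6 : 1 + a₀⁻¹ * (a * ‖x - y‖) ≤ (1 + a₀⁻¹) * (1 + a * ‖x - y‖) := by nlinarith
        have h7 : 0 ≤ a₀⁻¹ * (a * ‖x - y‖) := by positivity
        nlinarith
      _ = _ := by ring
  have h2 : ‖φ (a • (x - y))‖ ≤ ((1 + R) * (1 + a₀⁻¹)) ^ m * C * ((1 + ‖y‖) ^ m)⁻¹ := by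
    rw [← div_eq_mul_inv, le_div_iff₀ (by positivity)]
    calc ‖φ (a • (x - y))‖ * (1 + ‖y‖) ^ m
        ≤ ‖φ (a • (x - y))‖ * ((1 + R) * (1 + a₀⁻¹) * (1 + ‖a • (x - y)‖)) ^ m := by gcongr
      _ = ((1 + R) * (1 + a₀⁻¹)) ^ m * ((1 + ‖a • (x - y)‖) ^ m * ‖φ (a • (x - y))‖) := by
        rw [mul_pow]; ring
      _ ≤ _ := by
        have := h (a • (x - y))
        gcongr
  rw [norm_smul, norm_mul, norm_inv, Real.norm_of_nonneg (r := (1 + ‖y‖) ^ m) (by positivity)]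
  calc ‖u₀ y‖ * ‖φ (a • (x - y))‖
      ≤ ‖u₀ y‖ * (((1 + R) * (1 + a₀⁻¹)) ^ m * C * ((1 + ‖y‖) ^ m)⁻¹) := by gcongr
    _ = _ := by ring

lemma aestronglyMeasurable_smul {u₀ : V → ℝ} (hu : AEStronglyMeasurable u₀ volume) (φ : 𝓢(V, F))
    (a : ℝ) (x : V) : AEStronglyMeasurable (fun y => u₀ y • φ (a • (x - y))) volume := by
  have h : Continuous fun y => φ (a • (x - y)) := φ.continuous.comp (by fun_prop)
  exact hu.smul h.aestronglyMeasurable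

lemma WeightedIntegrable.integrable_smul {m : ℕ} {u₀ : V → ℝ} (hu : WeightedIntegrable m u₀)
    (φ : 𝓢(V, F)) {a : ℝ} (ha : 0 < a) (x : V) :
    Integrable fun y => u₀ y • φ (a • (x - y)) := by
  obtain ⟨D, hD⟩ := exists_norm_smul_le u₀ φ m ‖x‖ ha
  exact (hu.norm.const_mul D).mono' (aestronglyMeasurable_smul hu.aestronglyMeasurable φ a x)
    (Eventually.of_forall fun y => hD x le_rfl a le_rfl y)

lemma WeightedIntegrable.continuousAt_scaledConv {m : ℕ} {u₀ : V → ℝ}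
    (hu : WeightedIntegrable m u₀) (φ : 𝓢(V, F)) {p : V × ℝ} (hp : 0 < p.2) :
    ContinuousAt (fun q : V × ℝ => scaledConv u₀ φ q.2 q.1) p := by
  obtain ⟨D, hD⟩ := exists_norm_smul_le u₀ φ m (‖p.1‖ + 1) (half_pos hp)
  refine continuousAt_of_dominated (bound := fun y => D * ‖((1 + ‖y‖) ^ m)⁻¹ * u₀ y‖)
    (Eventually.of_forall fun q => aestronglyMeasurable_smul hu.aestronglyMeasurable φ _ _) ?_
    (hu.norm.const_mul D) (Eventually.of_forall fun y => ?_)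
  · have h1 : ∀ᶠ q : V × ℝ in 𝓝 p, ‖q.1‖ < ‖p.1‖ + 1 :=
      (continuous_fst.norm.tendsto p).eventually_lt_const (by simp)
    have h2 : ∀ᶠ q : V × ℝ in 𝓝 p, p.2 / 2 < q.2 :=
      (continuous_snd.tendsto p).eventually_const_lt (by linarith)
    filter_upwards [h1, h2] with q hq1 hq2
    exact Eventually.of_forall fun y => hD _ hq1.le _ hq2.le y
  · have : Continuous fun q : V × ℝ => u₀ y • φ (q.2 • (q.1 - y)) :=
      (φ.continuous.comp (by fun_prop)).const_smul _
    exact this.continuousAt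

lemma WeightedIntegrable.hasFDerivAt_scaledConv {m : ℕ} {u₀ : V → ℝ}
    (hu : WeightedIntegrable m u₀) (φ : 𝓢(V, F)) {a : ℝ} (ha : 0 < a) (x : V) :
    HasFDerivAt (scaledConv u₀ φ a) (a • scaledConv u₀ (SchwartzMap.fderivCLM ℝ V F φ) a x) x := by
  obtain ⟨D, hD⟩ := exists_norm_smul_le u₀ (SchwartzMap.fderivCLM ℝ V F φ) m (‖x‖ + 1) ha
  rw [scaledConv, ← integral_smul]
  refine hasFDerivAt_integral_of_dominated_of_fderiv_le (s := Metric.ball x 1)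
    (F := fun x y => u₀ y • φ (a • (x - y)))
    (F' := fun x y => a • u₀ y • SchwartzMap.fderivCLM ℝ V F φ (a • (x - y)))
    (bound := fun y => a * (D * ‖((1 + ‖y‖) ^ m)⁻¹ * u₀ y‖)) (Metric.ball_mem_nhds x one_pos)
    (Eventually.of_forall fun q => aestronglyMeasurable_smul hu.aestronglyMeasurable φ _ _)
    (hu.integrable_smul φ ha x)
    ((aestronglyMeasurable_smul hu.aestronglyMeasurable _ _ _).const_smul a)
    (Eventually.of_forall fun y z hz => ?_) ((hu.norm.const_mul D).const_mul a)
    (Eventually.of_forall fun y z hz => ?_)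
  · rw [norm_smul, Real.norm_of_nonneg ha.le]
    have hz' : ‖z‖ ≤ ‖x‖ + 1 := by
      have := norm_le_norm_add_norm_sub' z x
      rw [mem_ball_iff_norm] at hz
      linarith
    have := hD z hz' a le_rfl y
    gcongr
  · have h1 : HasFDerivAt (fun z : V => a • (z - y)) (a • ContinuousLinearMap.id ℝ V) z :=
      ((hasFDerivAt_id z).sub_const y).const_smul a
    have h2 := ((φ.hasFDerivAt (a • (z - y))).comp z h1).const_smul (u₀ y)
    convert! h2 using 1
    ext v
    simp [smul_comm a (u₀ y)]

lemma WeightedIntegrable.fderiv_scaledConv {m : ℕ} {u₀ : V → ℝ}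
    (hu : WeightedIntegrable m u₀) (φ : 𝓢(V, F)) {a : ℝ} (ha : 0 < a) :
    fderiv ℝ (scaledConv u₀ φ a) = a • scaledConv u₀ (SchwartzMap.fderivCLM ℝ V F φ) a :=
  funext fun x => (hu.hasFDerivAt_scaledConv φ ha x).fderiv

/-- The derivative is again a convolution of the same kind, with φ replaced by its derivative, so
the induction varies the target space. -/
lemma WeightedIntegrable.contDiff_scaledConv {m : ℕ} {u₀ : V → ℝ}
    (hu : WeightedIntegrable m u₀) {a : ℝ} (ha : 0 < a) (k : ℕ) :
    ∀ {F : Type} [NormedAddCommGroup F] [NormedSpace ℝ F] (φ : 𝓢(V, F)),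
      ContDiff ℝ k (scaledConv u₀ φ a) := by
  induction k with
  | zero =>
    intro F _ _ φ
    rw [Nat.cast_zero, contDiff_zero, continuous_iff_continuousAt]
    exact fun x => (hu.hasFDerivAt_scaledConv φ ha x).continuousAt
  | succ k ih =>
    intro F _ _ φ
    rw [Nat.cast_add, Nat.cast_one, contDiff_succ_iff_fderiv]
    refine ⟨fun x => (hu.hasFDerivAt_scaledConv φ ha x).differentiableAt, by simp, ?_⟩
    rw [hu.fderiv_scaledConv φ ha]
    exact (ih _).const_smul a

lemma WeightedIntegrable.laplacian_scaledConv {m : ℕ} {u₀ : V → ℝ}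
    (hu : WeightedIntegrable m u₀) [CompleteSpace F] (φ : 𝓢(V, F)) {a : ℝ} (ha : 0 < a) :
    Δ (scaledConv u₀ φ a) = a ^ 2 • scaledConv u₀ (Δ φ) a := by
  ext x
  rw [InnerProductSpace.laplacian_eq_iteratedFDeriv_orthonormalBasis _
    (stdOrthonormalBasis ℝ V)]
  have h1 : fderiv ℝ (fderiv ℝ (scaledConv u₀ φ a)) x = (a * a) •
      scaledConv u₀ (SchwartzMap.fderivCLM ℝ V _ (SchwartzMap.fderivCLM ℝ V F φ)) a x := by
    rw [hu.fderiv_scaledConv φ ha, fderiv_const_smul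
      (hu.hasFDerivAt_scaledConv _ ha x).differentiableAt, hu.fderiv_scaledConv _ ha, mul_smul]
    rfl
  have h2 := hu.integrable_smul
    (SchwartzMap.fderivCLM ℝ V _ (SchwartzMap.fderivCLM ℝ V F φ)) ha x
  have h3 : ∀ e : V, scaledConv u₀ (SchwartzMap.fderivCLM ℝ V _ (SchwartzMap.fderivCLM ℝ V F φ))
      a x e e = ∫ y, u₀ y • (∂_{e} (∂_{e} φ)) (a • (x - y)) := by
    intro e
    rw [scaledConv, ContinuousLinearMap.integral_apply h2,
      ContinuousLinearMap.integral_apply (h2.apply_continuousLinearMap e)]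
    congr 1
    ext y
    have h4 : ⇑(∂_{e} φ : 𝓢(V, F)) = fun z => fderiv ℝ φ z e := rfl
    have h5 : HasFDerivAt (fderiv ℝ φ) (fderiv ℝ (SchwartzMap.fderivCLM ℝ V F φ) (a • (x - y)))
      (a • (x - y)) := (SchwartzMap.fderivCLM ℝ V F φ).hasFDerivAt _
    rw [SchwartzMap.lineDerivOp_apply_eq_fderiv e (∂_{e} φ), h4,
      (h5.clm_apply (hasFDerivAt_const e _)).fderiv]
    simp
  have h6 : ∀ e : V, Integrable fun y => u₀ y • (∂_{e} (∂_{e} φ)) (a • (x - y)) :=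
    fun e => hu.integrable_smul _ ha x
  simp only [iteratedFDeriv_two_apply, h1, smul_apply]
  simp only [Matrix.cons_val_zero, Matrix.cons_val_one, h3, ← Finset.smul_sum]
  rw [← integral_finsetSum _ fun i _ => h6 _, Pi.smul_apply, pow_two, scaledConv]
  congr 2
  ext y
  rw [SchwartzMap.laplacian_eq_sum (stdOrthonormalBasis ℝ V), ← Finset.smul_sum]
  simp

end ScaledConvolution

/-! ### The evolution is a classical solution -/

lemma invScale_anti {s t : ℝ} (hs : 0 < s) (hst : s ≤ t) : invScale t ≤ invScale s :=
  Real.rpow_le_rpow_of_nonpos hs hst (by norm_num)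

lemma continuousAt_invScale {t : ℝ} (ht : 0 < t) : ContinuousAt invScale t :=
  Real.continuousAt_rpow_const _ _ (Or.inl ht.ne')

/-- The evolution `∫ u₀ y t^(-n/4) K(t^(-1/4)(x - y)) dy` of `u₀` by the biharmonic heat kernel. -/
noncomputable def evolution {n : ℕ} (u₀ : Space n → ℝ) (x : Space n) (t : ℝ) : ℝ :=
  invScale t ^ n * scaledConv u₀ (kernel n) (invScale t) x

lemma WeightedIntegrable.continuousOn_evolution {n m : ℕ} {u₀ : Space n → ℝ}
    (hu : WeightedIntegrable m u₀) :
    ContinuousOn (fun p : Space n × ℝ => evolution u₀ p.1 p.2) {p | 0 < p.2} := by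
  intro p hp
  have hp : 0 < p.2 := hp
  have h1 : ContinuousAt (fun p : Space n × ℝ => invScale p.2) p :=
    ContinuousAt.comp (f := Prod.snd) (continuousAt_invScale hp) continuousAt_snd
  have h2 : ContinuousAt (fun p : Space n × ℝ => (p.1, invScale p.2)) p :=
    continuousAt_fst.prodMk h1
  have h3 := hu.continuousAt_scaledConv (kernel n) (p := (p.1, invScale p.2)) (invScale_pos hp)
  exact ((h1.pow n).mul (ContinuousAt.comp (f := fun p : Space n × ℝ => (p.1, invScale p.2))
    h3 h2)).continuousWithinAt

lemma WeightedIntegrable.contDiff_evolution {n m : ℕ} {u₀ : Space n → ℝ}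
    (hu : WeightedIntegrable m u₀) {t : ℝ} (ht : 0 < t) :
    ContDiff ℝ 4 fun x => evolution u₀ x t :=
  contDiff_const.mul (hu.contDiff_scaledConv (invScale_pos ht) 4 (kernel n))

lemma WeightedIntegrable.bilaplacian_evolution {n m : ℕ} {u₀ : Space n → ℝ}
    (hu : WeightedIntegrable m u₀) {t : ℝ} (ht : 0 < t) (x : Space n) :
    bilaplacian (fun x => evolution u₀ x t) x =
      invScale t ^ (n + 4) * scaledConv u₀ (Δ (Δ (kernel n))) (invScale t) x := by
  have ha := invScale_pos ht
  have h0 : (fun x => evolution u₀ x t) =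
      invScale t ^ n • scaledConv u₀ (kernel n) (invScale t) := rfl
  have h1 : ∀ (c : ℝ) (φ : 𝓢(Space n, ℝ)), Δ (c • scaledConv u₀ φ (invScale t)) =
      (c * invScale t ^ 2) • scaledConv u₀ (Δ φ) (invScale t) := by
    intro c φ
    ext y
    rw [InnerProductSpace.laplacian_smul _ (hu.contDiff_scaledConv ha 2 φ).contDiffAt,
      hu.laplacian_scaledConv φ ha, mul_smul]
    rfl
  rw [bilaplacian, h0, h1, h1, Pi.smul_apply, smul_eq_mul]
  ring

lemma WeightedIntegrable.hasDerivAt_evolution {n m : ℕ} {u₀ : Space n → ℝ}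
    (hu : WeightedIntegrable m u₀) (x : Space n) {t : ℝ} (ht : 0 < t) :
    HasDerivAt (fun s => evolution u₀ x s) (-bilaplacian (fun z => evolution u₀ z t) x) t := by
  rw [hu.bilaplacian_evolution ht]
  have hball : Metric.ball t (t / 2) ∈ 𝓝 t := Metric.ball_mem_nhds t (by positivity)
  have hpos : ∀ s ∈ Metric.ball t (t / 2), t / 2 < s ∧ s < 2 * t := by
    intro s hs
    rw [Metric.mem_ball, Real.dist_eq, abs_lt] at hs
    constructor <;> linarith
  -- For t/2 < s < 2t the decreasing scale `invScale s` lies between its values at 2t and t/2: the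
  -- first is the lower bound needed here, the second bounds the prefactor.
  obtain ⟨D, hD⟩ := exists_norm_smul_le u₀ (Δ (Δ (kernel n))) m ‖x‖
    (invScale_pos (t := 2 * t) (by positivity))
  have key := hasDerivAt_integral_of_dominated_loc_of_deriv_le (μ := volume) (x₀ := t)
    (s := Metric.ball t (t / 2))
    (F := fun s y => u₀ y * (invScale s ^ n * kernel n (invScale s • (x - y))))
    (F' := fun s y => u₀ y *
      -(invScale s ^ (n + 4) * (Δ (Δ (kernel n))) (invScale s • (x - y))))
    (bound := fun y => invScale (t / 2) ^ (n + 4) * (D * ‖((1 + ‖y‖) ^ m)⁻¹ * u₀ y‖))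
    hball ?_ ?_ ?_ ?_ ?_ ?_
  · convert! key.2 using 1
    · ext s
      rw [evolution, scaledConv, ← integral_const_mul]
      congr 1
      ext y
      rw [smul_eq_mul]
      ring
    · rw [scaledConv, ← integral_const_mul, ← integral_neg]
      congr 1
      ext y
      rw [smul_eq_mul]
      ring
  · refine Eventually.of_forall fun s => ?_
    have := (aestronglyMeasurable_smul hu.aestronglyMeasurable (kernel n) (invScale s) x).const_mul
      (invScale s ^ n)
    convert! this using 2 with y
    rw [smul_eq_mul]
    ring
  · have := (hu.integrable_smul (kernel n) (invScale_pos ht) x).const_mul (invScale t ^ n)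
    convert! this using 2 with y
    rw [smul_eq_mul]
    ring
  · have := (aestronglyMeasurable_smul hu.aestronglyMeasurable (Δ (Δ (kernel n)))
      (invScale t) x).const_mul (-invScale t ^ (n + 4))
    convert! this using 2 with y
    rw [smul_eq_mul]
    ring
  · refine Eventually.of_forall fun y s hs => ?_
    obtain ⟨h1, h2⟩ := hpos s hs
    have hs0 : 0 < s := by linarith
    have h3 := hD x le_rfl _ (invScale_anti hs0 h2.le) y
    have h4 := invScale_anti (by positivity) h1.le
    have h5 := (invScale_pos hs0).le
    have h6 := (invScale_pos (half_pos ht)).le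
    calc _ = invScale s ^ (n + 4) * ‖u₀ y • (Δ (Δ (kernel n))) (invScale s • (x - y))‖ := by
          rw [norm_mul, norm_neg, norm_mul, Real.norm_of_nonneg (pow_nonneg h5 _), norm_smul]
          ring
      _ ≤ _ := by gcongr
  · exact (hu.norm.const_mul D).const_mul _
  · exact Eventually.of_forall fun y s hs =>
      (hasDerivAt_scaled_kernel (x - y) ((half_pos ht).trans (hpos s hs).1)).const_mul _

end BiharmonicHeat

/-! ### Attainment of the initial datum in L¹_loc -/

namespace BiharmonicHeat

open scoped SchwartzMap ENNReal

section InitialData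

variable {V F : Type} [NormedAddCommGroup V] [InnerProductSpace ℝ V] [FiniteDimensional ℝ V]
  [MeasurableSpace V] [BorelSpace V] [NormedAddCommGroup F] [NormedSpace ℝ F]

/-- The translation group acts continuously on L¹. The action by c is g ↦ g(c + ·), hence the sign
of w. -/
lemma tendsto_lintegral_translate_sub {g : V → ℝ} (hg : Integrable g) :
    Tendsto (fun w => ∫⁻ x, ‖g (x - w) - g x‖ₑ) (𝓝 0) (𝓝 0) := by
  have : Fact ((1 : ℝ≥0∞) ≠ ∞) := ⟨ENNReal.one_ne_top⟩
  have hg1 : MemLp g 1 volume := memLp_one_iff_integrable.2 hg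
  have h1 : Continuous fun w : V => DomAddAct.mk (-w) +ᵥ hg1.toLp g := by
    have : Continuous fun w : V => DomAddAct.mk (-w) :=
      DomAddAct.continuous_mk.comp continuous_neg
    exact this.vadd continuous_const
  have h2 : Continuous fun w : V => edist (DomAddAct.mk (-w) +ᵥ hg1.toLp g) (hg1.toLp g) :=
    h1.edist continuous_const
  have h3 := h2.tendsto 0
  have h4 : ∀ w : V, edist (DomAddAct.mk (-w) +ᵥ hg1.toLp g) (hg1.toLp g) =
      ∫⁻ x, ‖g (x - w) - g x‖ₑ := by
    intro w
    rw [DomAddAct.mk_vadd_toLp, Lp.edist_toLp_toLp, eLpNorm_one_eq_lintegral_enorm]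
    congr 1
    ext x
    simp [vadd_eq_add, neg_add_eq_sub]
  simp only [h4] at h3
  simpa using h3

lemma integrable_one_add_pow_mul (φ : 𝓢(V, ℝ)) (m : ℕ) :
    Integrable fun z => (1 + ‖z‖) ^ m * φ z := by
  have h := ((φ.integrable (μ := volume)).norm.add
    (φ.integrable_pow_mul volume m)).const_mul (2 ^ (m - 1))
  refine h.mono' (Continuous.aestronglyMeasurable ?_) (Eventually.of_forall fun z => ?_)
  · have := φ.continuous
    fun_prop
  · have := add_pow_le zero_le_one (norm_nonneg z) m
    rw [norm_mul, Real.norm_of_nonneg (by positivity), Pi.add_apply]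
    calc (1 + ‖z‖) ^ m * ‖φ z‖ ≤ 2 ^ (m - 1) * (1 ^ m + ‖z‖ ^ m) * ‖φ z‖ := by gcongr
      _ = _ := by rw [one_pow]; ring

omit [FiniteDimensional ℝ V] [InnerProductSpace ℝ V] [MeasurableSpace V] [BorelSpace V] in
lemma enorm_le_of_norm_le (u₀ : V → ℝ) (m : ℕ) {y : V} {S : ℝ} (hS : 1 + ‖y‖ ≤ S) :
    ‖u₀ y‖ₑ ≤ ENNReal.ofReal (S ^ m) * ‖((1 + ‖y‖) ^ m)⁻¹ * u₀ y‖ₑ := by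
  have h0 : 0 ≤ S := le_trans (by positivity) hS
  rw [← Real.enorm_of_nonneg (pow_nonneg h0 m), ← enorm_mul, enorm_le_iff_norm_le, norm_mul,
    norm_mul, norm_inv, Real.norm_of_nonneg (pow_nonneg h0 m),
    Real.norm_of_nonneg (r := (1 + ‖y‖) ^ m) (by positivity), ← mul_assoc, ← div_eq_mul_inv]
  refine le_mul_of_one_le_left (norm_nonneg _) ?_
  rw [one_le_div (by positivity)]
  gcongr

/-- A crude bound, but of polynomial growth in w, so that it stays integrable against the kernel. -/
lemma lintegral_translate_sub_le (u₀ : V → ℝ) (hm : Measurable u₀) (m : ℕ) {R : ℝ} (hR : 0 ≤ R)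
    (w : V) :
    ∫⁻ x in Metric.closedBall 0 R, ‖u₀ (x - w) - u₀ x‖ₑ ≤
      ENNReal.ofReal (((1 + R) * (1 + ‖w‖)) ^ m) *
        (2 * ∫⁻ y, ‖((1 + ‖y‖) ^ m)⁻¹ * u₀ y‖ₑ) := by
  set g : V → ℝ≥0∞ := fun y => ‖((1 + ‖y‖) ^ m)⁻¹ * u₀ y‖ₑ with hg
  have hgm : Measurable g := by fun_prop
  calc ∫⁻ x in Metric.closedBall 0 R, ‖u₀ (x - w) - u₀ x‖ₑ
      ≤ ∫⁻ x in Metric.closedBall 0 R,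
          ENNReal.ofReal (((1 + R) * (1 + ‖w‖)) ^ m) * (g (x - w) + g x) := by
        refine setLIntegral_mono' Metric.isClosed_closedBall.measurableSet fun x hx => ?_
        rw [mem_closedBall_zero_iff] at hx
        have h1 := norm_sub_le x w
        have h2 : 0 ≤ R * ‖w‖ := by positivity
        have h3 := norm_nonneg w
        rw [mul_add]
        exact enorm_sub_le.trans <| add_le_add (enorm_le_of_norm_le u₀ m (by nlinarith))
          (enorm_le_of_norm_le u₀ m (by nlinarith))
    _ ≤ ∫⁻ x, ENNReal.ofReal (((1 + R) * (1 + ‖w‖)) ^ m) * (g (x - w) + g x) :=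
        setLIntegral_le_lintegral _ _
    _ = _ := by
        rw [lintegral_const_mul _ (by fun_prop), lintegral_add_left (by fun_prop),
          lintegral_sub_right_eq_self, two_mul]

/-- For |w| ≤ 1 only the values of u₀ on the ball of radius R + 1 enter, and u₀ cut off to that ball
is integrable. -/
lemma tendsto_lintegral_closedBall_translate_sub {u₀ : V → ℝ} {m : ℕ}
    (hu : WeightedIntegrable m u₀) (R : ℝ) :
    Tendsto (fun w => ∫⁻ x in Metric.closedBall 0 R, ‖u₀ (x - w) - u₀ x‖ₑ) (𝓝 0) (𝓝 0) := by
  set B : Set V := Metric.closedBall 0 (R + 1)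
  have hB : MeasurableSet B := Metric.isClosed_closedBall.measurableSet
  have hg : Integrable (B.indicator u₀) := by
    rw [integrable_indicator_iff hB]
    have h1 : IntegrableOn (fun y => (1 + ‖y‖) ^ m * (((1 + ‖y‖) ^ m)⁻¹ * u₀ y)) B :=
      (Integrable.integrableOn hu).continuousOn_mul (Continuous.continuousOn (by fun_prop))
        (isCompact_closedBall _ _)
    refine h1.congr_fun (fun y _ => ?_) hB
    exact mul_inv_cancel_left₀ (by positivity) _
  refine tendsto_of_tendsto_of_tendsto_of_le_of_le' tendsto_const_nhds
    (tendsto_lintegral_translate_sub hg) (Eventually.of_forall fun _ => zero_le) ?_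
  filter_upwards [Metric.closedBall_mem_nhds (0 : V) one_pos] with w hw
  rw [mem_closedBall_zero_iff] at hw
  refine le_trans (le_of_eq ?_) (setLIntegral_le_lintegral (Metric.closedBall 0 R) _)
  refine setLIntegral_congr_fun Metric.isClosed_closedBall.measurableSet fun x hx => ?_
  rw [mem_closedBall_zero_iff] at hx
  have h1 : x ∈ B := by
    rw [mem_closedBall_zero_iff]; linarith
  have h2 : x - w ∈ B := by
    rw [mem_closedBall_zero_iff]; linarith [norm_sub_le x w]
  simp only [Set.indicator_of_mem h1, Set.indicator_of_mem h2]

end InitialData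

lemma evolution_eq_integral_sub {n : ℕ} (u₀ : Space n → ℝ) (x : Space n) {t : ℝ} (ht : 0 < t) :
    evolution u₀ x t = ∫ z, kernel n z * u₀ (x - (invScale t)⁻¹ • z) := by
  have ha := invScale_pos ht
  have h := Measure.integral_comp_smul volume
    (fun z : Space n => kernel n z * u₀ (x - (invScale t)⁻¹ • z)) (invScale t)
  rw [finrank_euclideanSpace_fin, abs_of_pos (by positivity), smul_eq_mul] at h
  rw [evolution, scaledConv, ← integral_sub_left_eq_self _ volume x]
  have h2 : ∀ y : Space n, u₀ (x - y) • kernel n (invScale t • (x - (x - y))) =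
      kernel n (invScale t • y) * u₀ (x - (invScale t)⁻¹ • invScale t • y) := by
    intro y
    rw [inv_smul_smul₀ ha.ne', sub_sub_cancel, smul_eq_mul, mul_comm]
  simp only [h2, h]
  rw [mul_inv_cancel_left₀ (by positivity)]

lemma WeightedIntegrable.integrable_kernel_mul {n m : ℕ} {u₀ : Space n → ℝ}
    (hu : WeightedIntegrable m u₀) (x : Space n) {t : ℝ} (ht : 0 < t) :
    Integrable fun z => kernel n z * u₀ (x - (invScale t)⁻¹ • z) := by
  have ha := invScale_pos ht
  have h := (hu.integrable_smul (kernel n) ha x).comp_sub_left x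
  rw [← integrable_comp_smul_iff volume _ ha.ne']
  refine h.congr (Eventually.of_forall fun y => ?_)
  simp only
  rw [inv_smul_smul₀ ha.ne', sub_sub_cancel, smul_eq_mul, mul_comm]

lemma tendsto_invScale_inv : Tendsto (fun t => (invScale t)⁻¹) (𝓝[>] 0) (𝓝 0) := by
  have h : Tendsto (fun t : ℝ => t ^ (1 / 4 : ℝ)) (𝓝[>] 0) (𝓝 0) := by
    have := (Real.continuousAt_rpow_const 0 (1 / 4) (Or.inr (by norm_num))).tendsto
    rw [Real.zero_rpow (by norm_num)] at this
    exact this.mono_left nhdsWithin_le_nhds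
  refine h.congr' ?_
  filter_upwards [self_mem_nhdsWithin] with t ht
  have ht : 0 < t := ht
  rw [invScale, Real.rpow_neg ht.le, inv_inv]

/-- As ∫ K = 1, u(x,t) - u₀(x) is the integral of K(z) (u₀(x - t^(1/4) z) - u₀(x)). Tonelli bounds
its L¹ norm on a ball by the integral of |K(z)| times the oscillation of u₀ under translation by
t^(1/4) z, and dominated convergence applies. -/
lemma WeightedIntegrable.tendsto_evolution_of_measurable {n m : ℕ} {u₀ : Space n → ℝ}
    (hu : WeightedIntegrable m u₀) (hm : Measurable u₀) {K : Set (Space n)} (hK : IsCompact K) :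
    Tendsto (fun t : ℝ => ∫⁻ x in K, ‖evolution u₀ x t - u₀ x‖ₑ) (𝓝[>] 0) (𝓝 0) := by
  obtain ⟨R, hR, hKR⟩ := hK.isBounded.subset_closedBall_lt 0 0
  set osc : Space n → ℝ≥0∞ := fun w => ∫⁻ x in Metric.closedBall 0 R, ‖u₀ (x - w) - u₀ x‖ₑ with hosc
  have hoscm : Measurable osc := by
    have : Measurable (Function.uncurry fun w x : Space n => ‖u₀ (x - w) - u₀ x‖ₑ) := by
      unfold Function.uncurry
      fun_prop
    exact this.lintegral_prod_right'
  have hKm : Measurable (kernel n) := (kernel n).continuous.measurable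
  set I := ∫⁻ y, ‖((1 + ‖y‖) ^ m)⁻¹ * u₀ y‖ₑ
  have hI : I < ∞ := hu.hasFiniteIntegral
  have hdom : Tendsto (fun t : ℝ => ∫⁻ z, ‖kernel n z‖ₑ * osc ((invScale t)⁻¹ • z)) (𝓝[>] 0)
      (𝓝 (∫⁻ _ : Space n, 0)) := by
    refine tendsto_lintegral_filter_of_dominated_convergence
      (fun z => ENNReal.ofReal ((1 + R) ^ m) * (2 * I) * ‖(1 + ‖z‖) ^ m * kernel n z‖ₑ)
      (Eventually.of_forall fun t => by fun_prop) ?_ ?_ (Eventually.of_forall fun z => ?_)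
    · have h1 : ∀ᶠ t in 𝓝[>] (0 : ℝ), (invScale t)⁻¹ < 1 :=
        tendsto_invScale_inv.eventually_lt_const one_pos
      filter_upwards [h1, self_mem_nhdsWithin] with t ht ht0
      refine Eventually.of_forall fun z => ?_
      have ha := invScale_pos ht0
      have h2 : ‖(invScale t)⁻¹ • z‖ ≤ ‖z‖ := by
        rw [norm_smul, Real.norm_of_nonneg (by positivity)]
        exact mul_le_of_le_one_left (norm_nonneg z) ht.le
      calc ‖kernel n z‖ₑ * osc ((invScale t)⁻¹ • z)
          ≤ ‖kernel n z‖ₑ * (ENNReal.ofReal (((1 + R) * (1 + ‖(invScale t)⁻¹ • z‖)) ^ m) *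
            (2 * I)) := by
            gcongr
            exact lintegral_translate_sub_le u₀ hm m hR.le _
        _ ≤ ‖kernel n z‖ₑ * (ENNReal.ofReal (((1 + R) * (1 + ‖z‖)) ^ m) * (2 * I)) := by
            gcongr
        _ = _ := by
            rw [mul_pow, ENNReal.ofReal_mul (by positivity), enorm_mul,
              Real.enorm_of_nonneg (r := (1 + ‖z‖) ^ m) (by positivity)]
            ring
    · rw [lintegral_const_mul _ (by fun_prop)]
      exact ENNReal.mul_ne_top (ENNReal.mul_ne_top ENNReal.ofReal_ne_top
        (ENNReal.mul_ne_top (by norm_num) hI.ne))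
        (integrable_one_add_pow_mul (kernel n) m).hasFiniteIntegral.ne
    · have h1 : Tendsto (fun t => (invScale t)⁻¹ • z) (𝓝[>] 0) (𝓝 0) := by
        simpa using tendsto_invScale_inv.smul_const z
      have h2 := (tendsto_lintegral_closedBall_translate_sub hu R).comp h1
      simpa using ENNReal.Tendsto.const_mul h2 (Or.inr enorm_ne_top)
  rw [lintegral_zero] at hdom
  refine tendsto_of_tendsto_of_tendsto_of_le_of_le' tendsto_const_nhds hdom
    (Eventually.of_forall fun _ => zero_le) ?_
  filter_upwards [self_mem_nhdsWithin] with t ht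
  have ht : 0 < t := ht
  calc ∫⁻ x in K, ‖evolution u₀ x t - u₀ x‖ₑ
      ≤ ∫⁻ x in Metric.closedBall 0 R, ‖evolution u₀ x t - u₀ x‖ₑ := lintegral_mono_set hKR
    _ ≤ ∫⁻ x in Metric.closedBall 0 R,
          ∫⁻ z, ‖kernel n z‖ₑ * ‖u₀ (x - (invScale t)⁻¹ • z) - u₀ x‖ₑ := by
        refine lintegral_mono fun x => ?_
        have h1 : evolution u₀ x t - u₀ x =
            ∫ z, kernel n z * (u₀ (x - (invScale t)⁻¹ • z) - u₀ x) := by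
          simp only [mul_sub]
          rw [integral_sub (hu.integrable_kernel_mul x ht)
            ((kernel n).integrable.mul_const _), integral_mul_const, integral_kernel, one_mul,
            evolution_eq_integral_sub u₀ x ht]
        rw [h1]
        refine (enorm_integral_le_lintegral_enorm _).trans (le_of_eq ?_)
        simp only [enorm_mul]
    _ = ∫⁻ z, ∫⁻ x in Metric.closedBall 0 R,
          ‖kernel n z‖ₑ * ‖u₀ (x - (invScale t)⁻¹ • z) - u₀ x‖ₑ := by
        refine lintegral_lintegral_swap (Measurable.aemeasurable ?_)
        unfold Function.uncurry
        fun_prop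
    _ = ∫⁻ z, ‖kernel n z‖ₑ * osc ((invScale t)⁻¹ • z) := by
        congr 1
        ext z
        rw [lintegral_const_mul _ (by fun_prop)]

/-- Tonelli required a measurable datum; neither the evolution nor the L¹ distance notices a change
of u₀ on a null set. -/
lemma WeightedIntegrable.tendsto_evolution {n m : ℕ} {u₀ : Space n → ℝ}
    (hu : WeightedIntegrable m u₀) {K : Set (Space n)} (hK : IsCompact K) :
    Tendsto (fun t : ℝ => ∫⁻ x in K, ‖evolution u₀ x t - u₀ x‖ₑ) (𝓝[>] 0) (𝓝 0) := by
  obtain ⟨v, hv, huv⟩ : AEStronglyMeasurable u₀ volume := hu.aestronglyMeasurable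
  have h1 : WeightedIntegrable m v := by
    refine Integrable.congr hu ?_
    filter_upwards [huv] with y hy
    rw [hy]
  have h2 : ∀ x t, evolution u₀ x t = evolution v x t := by
    intro x t
    rw [evolution, evolution, scaledConv, scaledConv]
    congr 1
    refine integral_congr_ae ?_
    filter_upwards [huv] with y hy
    rw [hy]
  refine (h1.tendsto_evolution_of_measurable hv.measurable hK).congr fun t => ?_
  refine lintegral_congr_ae ?_
  filter_upwards [ae_restrict_of_ae huv] with y hy
  rw [h2, hy]

theorem WeightedIntegrable.solvesCauchy_evolution {n m : ℕ} {u₀ : Space n → ℝ}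
    (hu : WeightedIntegrable m u₀) : SolvesCauchy u₀ (evolution u₀) where
  continuousOn := hu.continuousOn_evolution
  contDiff _ ht := hu.contDiff_evolution ht
  equation x _ ht := hu.hasDerivAt_evolution x ht
  initial _ hK := hu.tendsto_evolution hK

end BiharmonicHeat

/-! ### Polar coordinates and moments of the sphere -/

namespace BiharmonicHeat

open scoped SchwartzMap

section Polar

variable {n : ℕ} [Nonempty (Fin n)]

omit [Nonempty (Fin n)] in
lemma integral_volumeIoiPow (k : ℕ) (f : ℝ → ℝ) :
    ∫ r : Set.Ioi (0 : ℝ), f r ∂(Measure.volumeIoiPow k) =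
      ∫ r in Set.Ioi (0 : ℝ), r ^ k * f r := by
  simp only [Measure.volumeIoiPow, ENNReal.ofReal]
  rw [integral_withDensity_eq_integral_smul,
    integral_subtype_comap measurableSet_Ioi fun a => Real.toNNReal (a ^ k) • f a,
    setIntegral_congr_fun measurableSet_Ioi fun x hx => ?_]
  · rw [NNReal.smul_def, Real.coe_toNNReal _ (pow_nonneg (Set.mem_Ioi.1 hx).le _), smul_eq_mul]
  · exact (measurable_subtype_coe.pow_const _).real_toNNReal

omit [Nonempty (Fin n)] in
lemma norm_smul_homeomorph (x : ({0}ᶜ : Set (Space n))) :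
    ((homeomorphUnitSphereProd (Space n) x).2 : ℝ) •
      ((homeomorphUnitSphereProd (Space n) x).1 : Space n) = x := by
  have h := (homeomorphUnitSphereProd (Space n)).symm_apply_apply x
  conv_rhs => rw [← h]
  rfl

lemma integral_eq_integral_sphere_prod (h : Space n → ℝ) :
    ∫ x, h x = ∫ p : Metric.sphere (0 : Space n) 1 × Set.Ioi (0 : ℝ), h ((p.2 : ℝ) • (p.1 : Space n))
      ∂((volume : Measure (Space n)).toSphere.prod (Measure.volumeIoiPow (n - 1))) := by
  have key := (volume : Measure (Space n)).measurePreserving_homeomorphUnitSphereProd.integral_comp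
    (Homeomorph.measurableEmbedding _) (fun p => h ((p.2 : ℝ) • (p.1 : Space n)))
  simp only [norm_smul_homeomorph, finrank_euclideanSpace_fin] at key
  rw [← key, integral_subtype_comap (measurableSet_singleton _).compl h, restrict_compl_singleton]

omit [Nonempty (Fin n)] in
lemma integrable_sphere_prod {h : Space n → ℝ} (hi : Integrable h) :
    Integrable (fun p : Metric.sphere (0 : Space n) 1 × Set.Ioi (0 : ℝ) =>
      h ((p.2 : ℝ) • (p.1 : Space n)))
      ((volume : Measure (Space n)).toSphere.prod (Measure.volumeIoiPow (n - 1))) := by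
  have key :=
    (volume : Measure (Space n)).measurePreserving_homeomorphUnitSphereProd.integrable_comp_emb
    (Homeomorph.measurableEmbedding _) (g := fun p => h ((p.2 : ℝ) • (p.1 : Space n)))
  simp only [Function.comp_def, norm_smul_homeomorph, finrank_euclideanSpace_fin] at key
  rw [← key]
  have h2 := (integrableOn_iff_comap_subtypeVal
    (measurableSet_singleton (0 : Space n)).compl).1 hi.integrableOn
  exact h2

lemma integral_eq_integral_Ioi_sphere {h : Space n → ℝ} (hi : Integrable h) :
    ∫ x, h x = ∫ r in Set.Ioi (0 : ℝ), r ^ (n - 1) * ∫ w : Metric.sphere (0 : Space n) 1,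
      h (r • (w : Space n)) ∂(volume : Measure (Space n)).toSphere := by
  rw [integral_eq_integral_sphere_prod, integral_prod_symm _ (integrable_sphere_prod hi),
    integral_volumeIoiPow (n - 1) fun r => ∫ w : Metric.sphere (0 : Space n) 1,
      h (r • (w : Space n)) ∂(volume : Measure (Space n)).toSphere]

end Polar

lemma gamma_nat_add_half (k : ℕ) :
    Real.Gamma (k + 1 / 2) * (4 ^ k * k.factorial) = (2 * k).factorial * √Real.pi := by
  induction k with
  | zero => simp [-one_div, Real.Gamma_one_half_eq]
  | succ k ih =>
    have h : ((k + 1 : ℕ) : ℝ) + 1 / 2 = (k + 1 / 2) + 1 := by push_cast; ring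
    rw [h, Real.Gamma_add_one (by positivity), mul_add_one, Nat.factorial_succ k,
      Nat.factorial_succ (2 * k + 1), Nat.factorial_succ (2 * k)]
    push_cast
    linear_combination (2 * (2 * k + 1) * (k + 1)) * ih

lemma integral_pow_mul_exp_neg_sq (k : ℕ) :
    ∫ s : ℝ, s ^ (2 * k) * Real.exp (-s ^ 2) = Real.Gamma (k + 1 / 2) := by
  have h1 := integral_comp_abs (f := fun s => s ^ (2 * k) * Real.exp (-s ^ 2))
  simp only [pow_mul, sq_abs] at h1 ⊢
  rw [h1]
  have h2 := integral_rpow_mul_exp_neg_rpow (p := 2) (q := (2 * k : ℕ)) two_pos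
    (by have : (0 : ℝ) ≤ (2 * k : ℕ) := Nat.cast_nonneg _
        linarith)
  have h3 : (((2 * k : ℕ) : ℝ) + 1) / 2 = k + 1 / 2 := by push_cast; ring
  rw [h3] at h2
  have h4 : ∫ s in Set.Ioi (0 : ℝ), (s ^ 2) ^ k * Real.exp (-s ^ 2) =
      ∫ s in Set.Ioi (0 : ℝ), s ^ ((2 * k : ℕ) : ℝ) * Real.exp (-s ^ (2 : ℝ)) := by
    refine setIntegral_congr_fun measurableSet_Ioi fun s _ => ?_
    simp only [Real.rpow_natCast, Real.rpow_ofNat, pow_mul]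
  rw [h4, h2]
  ring

/-- A reflection exchanges the two vectors and preserves both the norm and the volume. -/
lemma integral_inner_pow_mul_exp_neg_norm_sq {n : ℕ} {e e' : Space n} (h : ‖e‖ = ‖e'‖) (k : ℕ) :
    ∫ ξ : Space n, inner ℝ ξ e ^ k * Real.exp (-‖ξ‖ ^ 2) =
      ∫ ξ : Space n, inner ℝ ξ e' ^ k * Real.exp (-‖ξ‖ ^ 2) := by
  set L := Submodule.reflection (Submodule.span ℝ {e - e'})ᗮ
  have hL : L e = e' := Submodule.reflection_sub h
  rw [← L.measurePreserving.integral_comp L.toHomeomorph.measurableEmbedding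
    (fun ξ : Space n => inner ℝ ξ e' ^ k * Real.exp (-‖ξ‖ ^ 2))]
  congr 1
  ext ξ
  rw [← hL, L.inner_map_map, L.norm_map]

/-- By rotational invariance e may be a coordinate vector, and the Gaussian factorizes; D collects
the n - 1 other coordinates. -/
lemma exists_integral_inner_pow {n : ℕ} [Nonempty (Fin n)] :
    ∃ D : ℝ, D ≠ 0 ∧ ∀ (e : Space n), ‖e‖ = 1 → ∀ k : ℕ,
      ∫ ξ : Space n, inner ℝ ξ e ^ (2 * k) * Real.exp (-‖ξ‖ ^ 2) =
        D * Real.Gamma (k + 1 / 2) := by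
  classical
  let i₀ : Fin n := Classical.arbitrary _
  refine ⟨∏ j ∈ Finset.univ.erase i₀, √Real.pi, Finset.prod_ne_zero_iff.2 fun _ _ => by positivity,
    fun e he k => ?_⟩
  rw [integral_inner_pow_mul_exp_neg_norm_sq (e' := EuclideanSpace.single i₀ (1 : ℝ)) (by simp [he])]
  rw [← (PiLp.volume_preserving_toLp (Fin n)).integral_comp
    (MeasurableEquiv.toLp 2 (Fin n → ℝ)).measurableEmbedding]
  have h1 : ∀ x : Fin n → ℝ, inner ℝ (WithLp.toLp 2 x) (EuclideanSpace.single i₀ (1 : ℝ)) ^ (2 * k) *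
      Real.exp (-‖WithLp.toLp 2 x‖ ^ 2) =
      ∏ j, (if j = i₀ then x j ^ (2 * k) * Real.exp (-x j ^ 2) else Real.exp (-x j ^ 2)) := by
    intro x
    rw [← Finset.mul_prod_erase _ _ (Finset.mem_univ i₀), if_pos rfl,
      Finset.prod_congr rfl fun j hj => if_neg (Finset.ne_of_mem_erase hj), mul_assoc,
      Finset.mul_prod_erase _ (fun j => Real.exp (-x j ^ 2)) (Finset.mem_univ i₀),
      ← Real.exp_sum, EuclideanSpace.norm_sq_eq]
    simp [EuclideanSpace.inner_single_right]
  simp only [h1]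
  rw [integral_fintype_prod_volume_eq_prod (fun (j : Fin n) (s : ℝ) =>
    if j = i₀ then s ^ (2 * k) * Real.exp (-s ^ 2) else Real.exp (-s ^ 2)),
    ← Finset.mul_prod_erase _ _ (Finset.mem_univ i₀), mul_comm]
  simp only [if_true, integral_pow_mul_exp_neg_sq]
  congr 1
  refine Finset.prod_congr rfl fun j hj => ?_
  simp only [if_neg (Finset.ne_of_mem_erase hj)]
  simpa using integral_gaussian 1

/-- The spherical average `∫_{|ω| = 1} cos(r⟪ω, e⟫) dω`. -/
noncomputable def sphereCos {n : ℕ} (e : Space n) (r : ℝ) : ℝ :=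
  ∫ w : Metric.sphere (0 : Space n) 1, Real.cos (r * inner ℝ (w : Space n) e)
    ∂(volume : Measure (Space n)).toSphere

/-- In polar coordinates the Gaussian moment is the spherical moment times Γ(k + n/2)/2, so a
division gives the spherical one. Only the independence of D from k and e matters. -/
lemma exists_integral_sphere_pow {n : ℕ} [Nonempty (Fin n)] :
    ∃ D : ℝ, D ≠ 0 ∧ ∀ (e : Space n), ‖e‖ = 1 → ∀ k : ℕ,
      ∫ w : Metric.sphere (0 : Space n) 1, inner ℝ (w : Space n) e ^ (2 * k)
        ∂(volume : Measure (Space n)).toSphere =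
          D * ((2 * k).factorial / (4 ^ k * k.factorial * Real.Gamma (k + n / 2))) := by
  obtain ⟨D, hD, h⟩ := exists_integral_inner_pow (n := n)
  refine ⟨2 * D * √Real.pi, by positivity, fun e he k => ?_⟩
  have hn : 0 < n := Fin.pos_iff_nonempty.2 inferInstance
  have hn' : (0 : ℝ) < n := by exact_mod_cast hn
  have h1 := h e he k
  have h2 : ∀ p : Metric.sphere (0 : Space n) 1 × Set.Ioi (0 : ℝ),
      inner ℝ ((p.2 : ℝ) • (p.1 : Space n)) e ^ (2 * k) *
        Real.exp (-‖(p.2 : ℝ) • (p.1 : Space n)‖ ^ 2) =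
      inner ℝ (p.1 : Space n) e ^ (2 * k) * ((p.2 : ℝ) ^ (2 * k) * Real.exp (-(p.2 : ℝ) ^ 2)) := by
    intro p
    rw [real_inner_smul_left, norm_smul, norm_eq_of_mem_sphere, mul_one, Real.norm_eq_abs, sq_abs]
    ring
  rw [integral_eq_integral_sphere_prod] at h1
  simp only [h2] at h1
  rw [integral_prod_mul (fun w : Metric.sphere (0 : Space n) 1 =>
    inner ℝ (w : Space n) e ^ (2 * k)) (fun r : Set.Ioi (0 : ℝ) =>
      (r : ℝ) ^ (2 * k) * Real.exp (-(r : ℝ) ^ 2)),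
    integral_volumeIoiPow (n - 1) fun r => r ^ (2 * k) * Real.exp (-r ^ 2)] at h1
  have h3 : ∫ r in Set.Ioi (0 : ℝ), r ^ (n - 1) * (r ^ (2 * k) * Real.exp (-r ^ 2)) =
      1 / 2 * Real.Gamma (k + n / 2) := by
    have h4 := integral_rpow_mul_exp_neg_rpow (p := 2) (q := (n - 1 + 2 * k : ℕ)) two_pos
      (by have : (0 : ℝ) ≤ (n - 1 + 2 * k : ℕ) := Nat.cast_nonneg _
          linarith)
    have h5 : (((n - 1 + 2 * k : ℕ) : ℝ) + 1) / 2 = k + n / 2 := by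
      rw [Nat.cast_add, Nat.cast_sub hn]; push_cast; ring
    rw [h5] at h4
    rw [← h4]
    refine setIntegral_congr_fun measurableSet_Ioi fun s _ => ?_
    simp only [Real.rpow_natCast, Real.rpow_ofNat, pow_add, mul_assoc]
  have hG : 0 < Real.Gamma (k + n / 2) := Real.Gamma_pos_of_pos (by positivity)
  have h6 := gamma_nat_add_half k
  rw [h3] at h1
  rw [mul_div_assoc', eq_div_iff (by positivity)]
  linear_combination (2 * 4 ^ k * k.factorial) * h1 + 2 * D * h6

lemma abs_inner_sphere_le {n : ℕ} {e : Space n} (he : ‖e‖ = 1) (w : Metric.sphere (0 : Space n) 1) :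
    |inner ℝ (w : Space n) e| ≤ 1 := by
  have := abs_real_inner_le_norm (w : Space n) e
  rwa [he, norm_eq_of_mem_sphere, mul_one] at this

lemma hasSum_sphereCos {n : ℕ} {e : Space n} (he : ‖e‖ = 1) (r : ℝ) :
    HasSum (fun k : ℕ => (-1) ^ k * r ^ (2 * k) / (2 * k).factorial *
      ∫ w : Metric.sphere (0 : Space n) 1, inner ℝ (w : Space n) e ^ (2 * k)
        ∂(volume : Measure (Space n)).toSphere) (sphereCos e r) := by
  simp only [← integral_const_mul]
  refine hasSum_integral_of_dominated_convergence
    (bound := fun k _ => |r| ^ (2 * k) / (2 * k).factorial)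
    (fun k => Continuous.aestronglyMeasurable (by fun_prop))
    (fun k => Eventually.of_forall fun w => ?_) (Eventually.of_forall fun w => ?_)
    (integrable_const _) (Eventually.of_forall fun w => ?_)
  · have h1 := abs_inner_sphere_le he w
    rw [norm_mul, norm_div, norm_mul, norm_pow, norm_pow, norm_pow]
    simp only [norm_neg, norm_one, one_pow, one_mul, Real.norm_eq_abs, Nat.abs_cast]
    exact mul_le_of_le_one_right (by positivity) (pow_le_one₀ (abs_nonneg _) h1)
  · have := (Real.summable_pow_div_factorial |r|).comp_injective
      (mul_right_injective₀ (two_ne_zero (α := ℕ)))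
    exact this
  · have := Real.hasSum_cos (r * inner ℝ (w : Space n) e)
    refine this.congr_fun fun k => ?_
    rw [mul_pow]
    ring

end BiharmonicHeat

/-! ### The Bessel profile is a multiple of the kernel -/

namespace BiharmonicHeat

open scoped SchwartzMap

/-- With ν = (n - 2)/2 one has Γ(k + ν + 1) = Γ(k + n/2), so the Bessel series agrees term by term
with the cosine series averaged over the sphere, up to a constant and a power of y. -/
lemma exists_besselJ_eq {n : ℕ} [Nonempty (Fin n)] :
    ∃ c : ℝ, c ≠ 0 ∧ ∀ (e : Space n), ‖e‖ = 1 → ∀ y : ℝ, 0 < y →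
      y ^ ((n : ℝ) / 2) * besselJ (((n : ℝ) - 2) / 2) y = c * (y ^ (n - 1) * sphereCos e y) := by
  obtain ⟨D, hD, h⟩ := exists_integral_sphere_pow (n := n)
  have hn : 0 < n := Fin.pos_iff_nonempty.2 inferInstance
  have hn' : (0 : ℝ) < n := by exact_mod_cast hn
  refine ⟨(1 / 2 : ℝ) ^ (((n : ℝ) - 2) / 2) / D, by positivity, fun e he y hy => ?_⟩
  have h1 := hasSum_sphereCos he y
  simp only [h e he] at h1
  have h2 : ∀ k : ℕ, (-1 : ℝ) ^ k * (y / 2) ^ (2 * (k : ℝ) + ((n : ℝ) - 2) / 2) /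
      ((k.factorial : ℝ) * Real.Gamma ((k : ℝ) + ((n : ℝ) - 2) / 2 + 1)) =
      (y / 2) ^ (((n : ℝ) - 2) / 2) / D * ((-1) ^ k * y ^ (2 * k) / (2 * k).factorial *
        (D * ((2 * k).factorial / (4 ^ k * k.factorial * Real.Gamma (k + n / 2))))) := by
    intro k
    have hG : 0 < Real.Gamma (k + n / 2) := Real.Gamma_pos_of_pos (by positivity)
    have h3 : (k : ℝ) + ((n : ℝ) - 2) / 2 + 1 = k + n / 2 := by ring
    have h4 : (y / 2) ^ (2 * (k : ℝ)) = y ^ (2 * k) / 4 ^ k := by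
      rw [show (2 * (k : ℝ)) = ((2 * k : ℕ) : ℝ) by push_cast; ring, Real.rpow_natCast, div_pow,
        pow_mul 2]
      norm_num
    rw [h3, Real.rpow_add (by positivity), h4]
    have : ((2 * k).factorial : ℝ) ≠ 0 := by positivity
    field_simp
  have h3 : y ^ ((n : ℝ) / 2) * (y / 2) ^ (((n : ℝ) - 2) / 2) =
      (1 / 2 : ℝ) ^ (((n : ℝ) - 2) / 2) * y ^ (n - 1) := by
    rw [div_eq_mul_one_div y, Real.mul_rpow hy.le (by norm_num), ← mul_assoc, ← Real.rpow_add hy,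
      ← Real.rpow_natCast y (n - 1), Nat.cast_sub hn, mul_comm]
    congr 2
    push_cast
    ring
  rw [besselJ]
  simp only [h2]
  rw [tsum_mul_left, h1.tsum_eq]
  linear_combination (sphereCos e y / D) * h3

/-- Polar coordinates and s = 2πr: the substitution turns the symbol into exp(-s⁴) and produces the
factor (2π)^n. -/
lemma kernel_eq_integral_sphereCos {n : ℕ} [Nonempty (Fin n)] {e : Space n} (he : ‖e‖ = 1) (y : ℝ) :
    (2 * Real.pi) ^ n * kernel n (y • e) =
      ∫ s in Set.Ioi (0 : ℝ), s ^ (n - 1) * (Real.exp (-s ^ 4) * sphereCos e (y * s)) := by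
  have hn : 0 < n := Fin.pos_iff_nonempty.2 inferInstance
  have hi : Integrable fun ξ : Space n =>
      Real.cos (2 * Real.pi * inner ℝ ξ (y • e)) * heatSymbol n ξ :=
    (heatSymbol n).integrable.bdd_mul (c := 1)
      (Continuous.aestronglyMeasurable (by fun_prop))
      (Eventually.of_forall fun ξ => Real.abs_cos_le_one _)
  rw [kernel, cosTransform_apply, integral_eq_integral_Ioi_sphere hi]
  have h1 : ∀ r ∈ Set.Ioi (0 : ℝ), r ^ (n - 1) * ∫ w : Metric.sphere (0 : Space n) 1,
      Real.cos (2 * Real.pi * inner ℝ (r • (w : Space n)) (y • e)) * heatSymbol n (r • (w : Space n))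
        ∂(volume : Measure (Space n)).toSphere =
      ((2 * Real.pi) ^ (n - 1))⁻¹ * ((2 * Real.pi * r) ^ (n - 1) *
        (Real.exp (-(2 * Real.pi * r) ^ 4) * sphereCos e (y * (2 * Real.pi * r)))) := by
    intro r hr
    have h2 : ∀ w : Metric.sphere (0 : Space n) 1,
        Real.cos (2 * Real.pi * inner ℝ (r • (w : Space n)) (y • e)) *
          heatSymbol n (r • (w : Space n)) =
        Real.cos (y * (2 * Real.pi * r) * inner ℝ (w : Space n) e) *
          Real.exp (-(2 * Real.pi * r) ^ 4) := by
      intro w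
      rw [heatSymbol_apply, norm_smul, norm_eq_of_mem_sphere, mul_one, Real.norm_eq_abs, sq_abs,
        real_inner_smul_left, real_inner_smul_right]
      congr 2 <;> ring
    simp only [h2]
    rw [integral_mul_const, ← sphereCos, mul_pow (2 * Real.pi) r (n - 1)]
    field_simp
  rw [setIntegral_congr_fun measurableSet_Ioi h1, integral_const_mul,
    integral_comp_mul_left_Ioi (fun s => s ^ (n - 1) *
      (Real.exp (-s ^ 4) * sphereCos e (y * s))) 0 (b := 2 * Real.pi) (by positivity), mul_zero,
    smul_eq_mul]
  obtain ⟨k, rfl⟩ : ∃ k, n = k + 1 := ⟨n - 1, by omega⟩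
  rw [pow_succ, Nat.add_sub_cancel]
  generalize (∫ s in Set.Ioi (0 : ℝ), s ^ k * (Real.exp (-s ^ 4) * sphereCos e (y * s))) = J
  field_simp

lemma exists_profile_eq {n : ℕ} [Nonempty (Fin n)] :
    ∃ c : ℝ, c ≠ 0 ∧ ∀ x : Space n, x ≠ 0 → profile n ‖x‖ = c * kernel n x := by
  obtain ⟨c, hc, h⟩ := exists_besselJ_eq (n := n)
  have hn : 0 < n := Fin.pos_iff_nonempty.2 inferInstance
  refine ⟨c * (2 * Real.pi) ^ n, by positivity, fun x hx => ?_⟩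
  have hx' : 0 < ‖x‖ := norm_pos_iff.2 hx
  have he : ‖(‖x‖⁻¹ • x)‖ = 1 := by
    rw [norm_smul, norm_inv, norm_norm, inv_mul_cancel₀ hx'.ne']
  have h1 := kernel_eq_integral_sphereCos he ‖x‖
  rw [smul_inv_smul₀ hx'.ne'] at h1
  rw [mul_assoc, h1, profile, ← integral_const_mul, ← integral_const_mul]
  refine setIntegral_congr_fun measurableSet_Ioi fun s hs => ?_
  have hs : 0 < s := hs
  have h2 := h _ he (‖x‖ * s) (by positivity)
  have h3 : ‖x‖ ^ (1 - (n : ℝ)) * ‖x‖ ^ (n - 1) = 1 := by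
    rw [← Real.rpow_natCast, ← Real.rpow_add hx', Nat.cast_sub hn]
    simp
  rw [mul_assoc (Real.exp _), h2, mul_pow]
  linear_combination (c * Real.exp (-s ^ 4) * s ^ (n - 1) *
    sphereCos (‖x‖⁻¹ • x) (‖x‖ * s)) * h3

lemma normConst_eq {n : ℕ} [Nonempty (Fin n)] {c : ℝ}
    (h : ∀ x : Space n, x ≠ 0 → profile n ‖x‖ = c * kernel n x) : normConst n = c⁻¹ := by
  have h1 : (fun x : Space n => profile n ‖x‖) =ᵐ[volume] fun x => c * kernel n x := by
    filter_upwards [Measure.ae_ne volume (0 : Space n)] with x hx using h x hx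
  rw [normConst, integral_congr_ae h1, integral_const_mul, integral_kernel, mul_one]

lemma solution_eq_evolution {n : ℕ} [Nonempty (Fin n)] (u₀ : Space n → ℝ) (x : Space n) {t : ℝ}
    (ht : 0 < t) : solution n u₀ x t = evolution u₀ x t := by
  obtain ⟨c, hc, h⟩ := exists_profile_eq (n := n)
  have ha := invScale_pos ht
  have h1 : (fun y : Space n => u₀ (x - y) * profile n (‖y‖ / t ^ (1 / 4 : ℝ))) =ᵐ[volume]
      fun y => c * (u₀ (x - y) * kernel n (invScale t • y)) := by
    filter_upwards [Measure.ae_ne volume (0 : Space n)] with y hy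
    have h2 : ‖y‖ / t ^ (1 / 4 : ℝ) = ‖invScale t • y‖ := by
      rw [norm_smul, Real.norm_of_nonneg ha.le, invScale, Real.rpow_neg ht.le, inv_mul_eq_div]
    rw [h2, h _ (smul_ne_zero ha.ne' hy)]
    ring
  have h3 : t ^ (-(n : ℝ) / 4) = invScale t ^ n := by
    rw [invScale, ← Real.rpow_natCast, ← Real.rpow_mul ht.le]
    congr 1
    ring
  rw [solution, normConst_eq h, integral_congr_ae h1, integral_const_mul, evolution, scaledConv, h3,
    ← integral_sub_left_eq_self _ volume x]
  simp only [sub_sub_cancel, smul_eq_mul]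
  field_simp

end BiharmonicHeat

/-! ### Positive integrable data: change of sign -/

namespace BiharmonicHeat

open scoped SchwartzMap

lemma tendsto_invScale_atTop : Tendsto invScale atTop (𝓝 0) :=
  tendsto_rpow_neg_atTop (by norm_num)

lemma tendsto_integral_mul_kernel {n : ℕ} {u₀ : Space n → ℝ} (hu : Integrable u₀) (z : Space n) :
    Tendsto (fun a : ℝ => ∫ y, u₀ y * kernel n (z - a • y)) (𝓝 0)
      (𝓝 ((∫ y, u₀ y) * kernel n z)) := by
  obtain ⟨C, hC, h⟩ := exists_one_add_pow_mul_norm_le (kernel n) 0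
  simp only [pow_zero, one_mul] at h
  have hK := (kernel n).continuous
  have hcont : ContinuousAt (fun a : ℝ => ∫ y, u₀ y * kernel n (z - a • y)) 0 := by
    refine continuousAt_of_dominated (bound := fun y => ‖u₀ y‖ * C)
      (Eventually.of_forall fun a => hu.aestronglyMeasurable.mul
        (Continuous.aestronglyMeasurable (by fun_prop)))
      (Eventually.of_forall fun a => Eventually.of_forall fun y => ?_) (hu.norm.mul_const C)
      (Eventually.of_forall fun y => Continuous.continuousAt (by fun_prop))
    rw [norm_mul]
    have := h (z - a • y)
    gcongr
  have := hcont.tendsto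
  simpa only [zero_smul, sub_zero, integral_mul_const] using this

lemma evolution_inv_smul {n : ℕ} (u₀ : Space n → ℝ) (z : Space n) {t : ℝ} (ht : 0 < t) :
    evolution u₀ ((invScale t)⁻¹ • z) t =
      invScale t ^ n * ∫ y, u₀ y * kernel n (z - invScale t • y) := by
  simp only [evolution, scaledConv, smul_sub, smul_inv_smul₀ (invScale_pos ht).ne', smul_eq_mul]

/-- At x = t^(1/4) z the rescaled solution tends to (∫ u₀) K(z) with ∫ u₀ > 0; the choice z = 0
gives positive values, and a zero-free point with K(z) < 0 gives negative ones. -/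
lemma evolution_changes_sign {n : ℕ} (hn : 1 ≤ n) {u₀ : Space n → ℝ} (hpos : ∀ᵐ x, 0 < u₀ x)
    (hu : Integrable u₀) :
    ∃ T : ℝ, 0 < T ∧ ∀ t : ℝ, T < t →
      (∃ x, 0 < evolution u₀ x t) ∧ (∃ x, evolution u₀ x t < 0) := by
  have hint : 0 < ∫ y, u₀ y := by
    rw [integral_pos_iff_support_of_nonneg_ae (hpos.mono fun x hx => hx.le) hu]
    have : (Function.support u₀) =ᵐ[volume] Set.univ := by
      filter_upwards [hpos] with x hx
      exact propext ⟨fun _ => trivial, fun _ => hx.ne'⟩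
    rw [measure_congr this, Measure.measure_univ_pos]
    exact NeZero.ne _
  obtain ⟨z, hz⟩ := exists_kernel_neg hn
  have h1 := ((tendsto_integral_mul_kernel hu 0).comp tendsto_invScale_atTop).eventually_const_lt
    (mul_pos hint (kernel_zero_pos n))
  have h2 := ((tendsto_integral_mul_kernel hu z).comp tendsto_invScale_atTop).eventually_lt_const
    (mul_neg_of_pos_of_neg hint hz)
  obtain ⟨T, hT⟩ := eventually_atTop.1 (h1.and h2)
  refine ⟨max T 1, by positivity, fun t ht => ?_⟩
  have ht0 : 0 < t := one_pos.trans ((le_max_right T 1).trans_lt ht)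
  have ha := pow_pos (invScale_pos ht0) n
  obtain ⟨h3, h4⟩ := hT t ((le_max_left T 1).trans ht.le)
  refine ⟨⟨(invScale t)⁻¹ • 0, ?_⟩, ⟨(invScale t)⁻¹ • z, ?_⟩⟩
  · rw [evolution_inv_smul u₀ 0 ht0]
    exact mul_pos ha h3
  · rw [evolution_inv_smul u₀ z ht0]
    exact mul_neg_of_pos_of_neg ha h4

lemma integrable_of_integrable_one_add_mul {n : ℕ} {u₀ : Space n → ℝ}
    (h : Integrable fun x => (1 + ‖x‖ ^ 4) * u₀ x) : Integrable u₀ := by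
  have h1 : Continuous fun x : Space n => (1 + ‖x‖ ^ 4)⁻¹ :=
    Continuous.inv₀ (by fun_prop) fun x => by positivity
  refine (h.bdd_mul (c := 1) h1.aestronglyMeasurable (Eventually.of_forall fun x => ?_)).congr
    (Eventually.of_forall fun x => inv_mul_cancel_left₀ (by positivity) _)
  rw [norm_inv, Real.norm_of_nonneg (by positivity)]
  exact inv_le_one_of_one_le₀ (by linarith [pow_nonneg (norm_nonneg x) 4])

lemma SolvesCauchy.congr {n : ℕ} {u₀ : Space n → ℝ} {u v : Space n → ℝ → ℝ}
    (hu : SolvesCauchy u₀ u) (h : ∀ x t, 0 < t → v x t = u x t) : SolvesCauchy u₀ v where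
  continuousOn := hu.continuousOn.congr fun p hp => h p.1 p.2 hp
  contDiff t ht := by
    simp only [h _ t ht]
    exact hu.contDiff t ht
  equation x t ht := by
    simp only [h _ t ht]
    refine (hu.equation x t ht).congr_of_eventuallyEq ?_
    filter_upwards [lt_mem_nhds ht] with s hs using h x s hs
  initial K hK := by
    refine (hu.initial K hK).congr' ?_
    filter_upwards [self_mem_nhdsWithin] with t ht
    simp only [h _ t ht]

lemma WeightedIntegrable.solvesCauchy_solution {n m : ℕ} [Nonempty (Fin n)] {u₀ : Space n → ℝ}
    (hu : WeightedIntegrable m u₀) : SolvesCauchy u₀ (solution n u₀) :=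
  hu.solvesCauchy_evolution.congr fun x _ ht => solution_eq_evolution u₀ x ht

theorem solvesCauchy_and_changes_sign {n : ℕ} (hn : 1 ≤ n) {u₀ : Space n → ℝ}
    (hpos : ∀ᵐ x, 0 < u₀ x) (h : Integrable fun x => (1 + ‖x‖ ^ 4) * u₀ x) :
    SolvesCauchy u₀ (solution n u₀) ∧
      ∃ T : ℝ, 0 < T ∧ ∀ t : ℝ, T < t →
        (∃ x, 0 < solution n u₀ x t) ∧ (∃ x, solution n u₀ x t < 0) := by
  have : Nonempty (Fin n) := ⟨⟨0, hn⟩⟩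
  have hu := integrable_of_integrable_one_add_mul h
  have hw : WeightedIntegrable 0 u₀ := by simpa [WeightedIntegrable] using hu
  refine ⟨hw.solvesCauchy_solution, ?_⟩
  obtain ⟨T, hT, hs⟩ := evolution_changes_sign hn hpos hu
  refine ⟨T, hT, fun t ht => ?_⟩
  simp only [solution_eq_evolution u₀ _ (hT.trans ht)]
  exact hs t ht

end BiharmonicHeat

/-! ### Slowly decaying data in dimension one: positivity -/

namespace BiharmonicHeat

open scoped SchwartzMap

lemma weightedIntegrable_norm_rpow_neg {β : ℝ} (h0 : 0 < β) (h1 : β < 1) :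
    WeightedIntegrable 2 fun x : Space 1 => ‖x‖ ^ (-β) := by
  have key := (integrable_fun_norm_addHaar (volume : Measure (Space 1))
    (f := fun r => ((1 + r) ^ 2)⁻¹ * r ^ (-β))).2
  refine key ?_
  simp only [finrank_euclideanSpace_fin, Nat.sub_self, pow_zero, one_smul]
  have hm : ∀ s : Set ℝ, AEStronglyMeasurable (fun r : ℝ => ((1 + r) ^ 2)⁻¹ * r ^ (-β))
      (volume.restrict s) := fun s => Measurable.aestronglyMeasurable (by fun_prop)
  rw [← Set.Ioc_union_Ioi_eq_Ioi zero_le_one]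
  refine IntegrableOn.union ?_ ?_
  · have h2 : IntegrableOn (fun r : ℝ => r ^ (-β)) (Set.Ioc 0 1) :=
      (intervalIntegrable_iff_integrableOn_Ioc_of_le zero_le_one).1
        (intervalIntegral.intervalIntegrable_rpow' (by linarith))
    refine h2.mono' (hm _) ((ae_restrict_iff' measurableSet_Ioc).2 (Eventually.of_forall ?_))
    intro r hr
    have hr0 : 0 < r := hr.1
    rw [Real.norm_of_nonneg (by positivity)]
    refine mul_le_of_le_one_left (by positivity) (inv_le_one_of_one_le₀ ?_)
    exact one_le_pow₀ (by linarith)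
  · have h2 : IntegrableOn (fun r : ℝ => r ^ (-2 : ℝ)) (Set.Ioi 1) :=
      integrableOn_Ioi_rpow_of_lt (by norm_num) one_pos
    refine h2.mono' (hm _) ((ae_restrict_iff' measurableSet_Ioi).2 (Eventually.of_forall ?_))
    intro r hr
    have hr1 : 1 < r := hr
    rw [Real.norm_of_nonneg (by positivity)]
    refine (mul_le_of_le_one_right (by positivity)
      (Real.rpow_le_one_of_one_le_of_nonpos hr1.le (by linarith))).trans ?_
    rw [Real.rpow_neg (by positivity), Real.rpow_ofNat]
    gcongr
    linarith

/-- This is linearization in β, with |log r| absorbed into powers. For r ≤ 1, r^(-β) ≤ r^(-1/4) and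
-log r ≤ 2 r^(-1/2) give the exponent -3/4, still integrable at 0 on the line. -/
lemma abs_rpow_neg_sub_one_le {β r : ℝ} (h0 : 0 < β) (h1 : β ≤ 1 / 4) (hr : 0 < r) :
    |r ^ (-β) - 1| ≤ β * (r + 2 * r ^ (-(3 / 4) : ℝ)) := by
  have h2 : 0 < r ^ (-(3 / 4) : ℝ) := by positivity
  rcases le_total 1 r with h | h
  · have h3 : r ^ (-β) ≤ 1 := Real.rpow_le_one_of_one_le_of_nonpos h (by linarith)
    rw [abs_of_nonpos (by linarith)]
    have h4 := Real.add_one_le_exp (Real.log r * -β)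
    rw [← Real.rpow_def_of_pos hr] at h4
    have h5 : Real.log r ≤ r := (Real.log_le_sub_one_of_pos hr).trans (by linarith)
    nlinarith [mul_le_mul_of_nonneg_left h5 h0.le, mul_pos h0 h2]
  · have h3 : 1 ≤ r ^ (-β) := Real.one_le_rpow_of_pos_of_le_one_of_nonpos hr h (by linarith)
    rw [abs_of_nonneg (by linarith)]
    have h4 := Real.add_one_le_exp (Real.log r * β)
    rw [← Real.rpow_def_of_pos hr] at h4
    have h5 : r ^ (-β) * r ^ β = 1 := by
      rw [← Real.rpow_add hr, neg_add_cancel, Real.rpow_zero]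
    have h6 : -Real.log r ≤ 2 * r ^ (-(1 / 2) : ℝ) := by
      have := Real.log_le_rpow_div (x := r⁻¹) (ε := 1 / 2) (by positivity) (by norm_num)
      rw [Real.log_inv, Real.inv_rpow hr.le, ← Real.rpow_neg hr.le] at this
      linarith
    have h7 : r ^ (-β) ≤ r ^ (-(1 / 4) : ℝ) :=
      Real.rpow_le_rpow_of_exponent_ge hr h (by linarith)
    have h8 : r ^ (-(1 / 4) : ℝ) * r ^ (-(1 / 2) : ℝ) = r ^ (-(3 / 4) : ℝ) := by
      rw [← Real.rpow_add hr]; norm_num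
    calc r ^ (-β) - 1 ≤ r ^ (-β) * (β * -Real.log r) := by nlinarith
      _ ≤ r ^ (-(1 / 4) : ℝ) * (β * (2 * r ^ (-(1 / 2) : ℝ))) := by
          have h9 : 0 ≤ -Real.log r := by linarith [Real.log_nonpos hr.le h]
          gcongr
      _ = β * (2 * r ^ (-(3 / 4) : ℝ)) := by rw [← h8]; ring
      _ ≤ _ := by nlinarith

lemma integral_mul_comp_sub_smul (g : Space 1 → ℝ) (x : Space 1) {R : ℝ} (hR : 0 < R) :
    ∫ w, R * g (x - R • w) = ∫ z, g z := by
  have h := Measure.integral_comp_smul volume (fun z : Space 1 => g (x - z)) R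
  rw [integral_sub_left_eq_self g volume x, finrank_euclideanSpace_fin, pow_one,
    abs_of_pos (by positivity), smul_eq_mul] at h
  rw [integral_const_mul, h, mul_inv_cancel_left₀ hR.ne']

lemma integrable_mul_comp_sub_smul {g : Space 1 → ℝ} (hg : Integrable g) (x : Space 1) {R : ℝ}
    (hR : 0 < R) : Integrable fun w => R * g (x - R • w) :=
  ((integrable_comp_smul_iff volume (fun z : Space 1 => g (x - z)) hR.ne').2
    (hg.comp_sub_left x)).const_mul R

/-- Near the singularity w = 0 the point x - Rw, with R = max(1, |x|), is as far from 0 as R allows.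
Decay of K then compensates the prefactor R in R K(x - Rw). -/
lemma max_one_norm_le {x w : Space 1} (hw : ‖w‖ ≤ 1 / 2) :
    max 1 ‖x‖ ≤ 2 * (1 + ‖x - max 1 ‖x‖ • w‖) := by
  set R := max 1 ‖x‖ with hR
  have hR0 : 0 < R := by positivity
  have h1 : ‖x‖ ≤ ‖x - R • w‖ + ‖R • w‖ := by
    simpa using norm_add_le (x - R • w) (R • w)
  have h2 : ‖R • w‖ ≤ R * (1 / 2) := by
    rw [norm_smul, Real.norm_of_nonneg hR0.le]
    gcongr
  have h3 := norm_nonneg (x - R • w)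
  rcases max_choice 1 ‖x‖ with h | h <;> rw [← hR] at h <;> linarith

lemma norm_le_one_add {x w : Space 1} : ‖w‖ ≤ 1 + ‖x - max 1 ‖x‖ • w‖ := by
  set R := max 1 ‖x‖ with hR
  have hR1 : 1 ≤ R := le_max_left _ _
  have hR2 : ‖x‖ ≤ R := le_max_right _ _
  have h1 : ‖R • w‖ ≤ ‖x‖ + ‖x - R • w‖ := by
    simpa [norm_sub_rev] using norm_le_norm_add_norm_sub' (R • w) x
  rw [norm_smul, Real.norm_of_nonneg (by positivity)] at h1
  have h3 := norm_nonneg (x - R • w)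
  have h4 : R * ‖w‖ ≤ R * (1 + ‖x - R • w‖) := by nlinarith
  exact le_of_mul_le_mul_left h4 (by positivity)

/-- The function R K(x - Rw), R = max(1, |x|), has integral 1 in w. Replacing |w|^(-β) by 1 costs at
most βS with S independent of x, so β(S + 1) < 1 suffices. -/
lemma exists_integral_norm_rpow_mul_kernel_pos :
    ∃ β₀ : ℝ, 0 < β₀ ∧ β₀ ≤ 1 / 4 ∧ ∀ β : ℝ, 0 < β → β < β₀ → ∀ x : Space 1,
      0 < ∫ w : Space 1, ‖w‖ ^ (-β) * (max 1 ‖x‖ * kernel 1 (x - max 1 ‖x‖ • w)) := by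
  obtain ⟨C, hC, hCb⟩ := exists_one_add_pow_mul_norm_le (kernel 1) 1
  simp only [pow_one] at hCb
  set W : Space 1 → ℝ := fun w => ((1 + ‖w‖) ^ 2)⁻¹ * ‖w‖ ^ (-(3 / 4) : ℝ) with hW
  have hWi : Integrable W := weightedIntegrable_norm_rpow_neg (by norm_num) (by norm_num)
  have hWn : ∀ w, 0 ≤ W w := fun w => by positivity
  set G : Space 1 → ℝ := fun z => (1 + ‖z‖) * ‖kernel 1 z‖ with hG
  have hGi : Integrable G := by
    refine (integrable_one_add_pow_mul (kernel 1) 1).norm.congr (Eventually.of_forall fun z => ?_)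
    simp only [pow_one, norm_mul, hG]
    rw [Real.norm_of_nonneg (by positivity)]
  have hGn : ∀ z, 0 ≤ G z := fun z => by positivity
  -- The coefficients are 5 = 1 + 2·2 and 16 = 2·8: one G from the term |w|, and twice the bound
  -- `hsing` from the singular term.
  set S : ℝ := 5 * (∫ z, G z) + 16 * C * ∫ w, W w with hS
  have hS0 : 0 ≤ S := by
    have := integral_nonneg (μ := volume) (f := G) fun z => hGn z
    have := integral_nonneg (μ := volume) (f := W) fun w => hWn w
    positivity
  refine ⟨min (1 / 4) (1 / (S + 1)), by positivity, min_le_left _ _, fun β h0 h1 x => ?_⟩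
  have hβ4 : β ≤ 1 / 4 := h1.le.trans (min_le_left _ _)
  have hβS : β * S < 1 := by
    have h2 := h1.trans_le (min_le_right _ _)
    rw [lt_div_iff₀ (by positivity)] at h2
    nlinarith
  set R := max 1 ‖x‖ with hR
  have hR0 : 0 < R := by positivity
  set k : Space 1 → ℝ := fun w => R * kernel 1 (x - R • w) with hk
  have hki : Integrable k := integrable_mul_comp_sub_smul (kernel 1).integrable x hR0
  have hk1 : ∫ w, k w = 1 := by
    rw [hk, integral_mul_comp_sub_smul (kernel 1) x hR0, integral_kernel]
  set B : Space 1 → ℝ := fun w => β * (5 * (R * G (x - R • w)) + 16 * C * W w) with hB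
  have hGR : Integrable fun w => R * G (x - R • w) := integrable_mul_comp_sub_smul hGi x hR0
  have hBi : Integrable B := ((hGR.const_mul 5).add (hWi.const_mul (16 * C))).const_mul β
  have hBint : ∫ w, B w = β * S := by
    rw [hB, integral_const_mul, integral_add (hGR.const_mul 5) (hWi.const_mul (16 * C)),
      integral_const_mul, integral_mul_comp_sub_smul G x hR0, integral_const_mul]
  have hknorm : ∀ w, ‖k w‖ = R * ‖kernel 1 (x - R • w)‖ := fun w => by
    rw [hk, norm_mul, Real.norm_of_nonneg hR0.le]
  have hkG : ∀ w, ‖k w‖ ≤ R * G (x - R • w) := fun w => by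
    rw [hknorm]
    have : ‖kernel 1 (x - R • w)‖ ≤ G (x - R • w) :=
      le_mul_of_one_le_left (norm_nonneg _) (by linarith [norm_nonneg (x - R • w)])
    gcongr
  have hwk : ∀ w, ‖w‖ * ‖k w‖ ≤ R * G (x - R • w) := fun w => by
    rw [hknorm, hG]
    have := norm_le_one_add (x := x) (w := w)
    rw [← hR] at this
    calc ‖w‖ * (R * ‖kernel 1 (x - R • w)‖)
        ≤ (1 + ‖x - R • w‖) * (R * ‖kernel 1 (x - R • w)‖) := by gcongr
      _ = _ := by ring
  have hsing : ∀ w, w ≠ 0 → ‖w‖ ^ (-(3 / 4) : ℝ) * ‖k w‖ ≤ 2 * (R * G (x - R • w)) + 8 * C * W w := by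
    intro w hw
    have hw0 : 0 < ‖w‖ := norm_pos_iff.2 hw
    -- For |w| ≤ 1/2 the kernel factor is bounded by 2C and the singular power is integrable; for
    -- |w| ≥ 1/2 the power is at most 2.
    rcases le_total ‖w‖ (1 / 2) with h | h
    · have h2 : ‖k w‖ ≤ 2 * C := by
        rw [hknorm]
        have h3 := max_one_norm_le (x := x) h
        rw [← hR] at h3
        calc R * ‖kernel 1 (x - R • w)‖
            ≤ 2 * (1 + ‖x - R • w‖) * ‖kernel 1 (x - R • w)‖ := by gcongr
          _ = 2 * ((1 + ‖x - R • w‖) * ‖kernel 1 (x - R • w)‖) := by ring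
          _ ≤ 2 * C := by
            have := hCb (x - R • w)
            gcongr
      have h3 : ‖w‖ ^ (-(3 / 4) : ℝ) ≤ 4 * W w := by
        rw [hW, ← mul_assoc]
        refine le_mul_of_one_le_left (by positivity) ?_
        rw [← div_eq_mul_inv, one_le_div (by positivity)]
        nlinarith
      calc ‖w‖ ^ (-(3 / 4) : ℝ) * ‖k w‖ ≤ 4 * W w * (2 * C) := by gcongr
        _ = 8 * C * W w := by ring
        _ ≤ _ := le_add_of_nonneg_left (by have := hGn (x - R • w); positivity)
    · have h2 : ‖w‖ ^ (-(3 / 4) : ℝ) ≤ 2 := by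
        calc ‖w‖ ^ (-(3 / 4) : ℝ) ≤ (1 / 2 : ℝ) ^ (-(3 / 4) : ℝ) :=
              Real.rpow_le_rpow_of_nonpos (by norm_num) h (by norm_num)
          _ ≤ (1 / 2 : ℝ) ^ (-1 : ℝ) :=
              Real.rpow_le_rpow_of_exponent_ge (by norm_num) (by norm_num) (by norm_num)
          _ = 2 := by rw [Real.rpow_neg_one]; norm_num
      calc ‖w‖ ^ (-(3 / 4) : ℝ) * ‖k w‖ ≤ 2 * (R * G (x - R • w)) := by
            have := hkG w
            gcongr
        _ ≤ _ := le_add_of_nonneg_right (by have := hWn w; positivity)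
  have hbound : ∀ᵐ w, ‖(‖w‖ ^ (-β) - 1) * k w‖ ≤ B w := by
    filter_upwards [Measure.ae_ne volume (0 : Space 1)] with w hw
    have h2 := abs_rpow_neg_sub_one_le h0 hβ4 (norm_pos_iff.2 hw)
    have h3 := hsing w hw
    have h4 := hwk w
    rw [norm_mul, Real.norm_eq_abs]
    calc |‖w‖ ^ (-β) - 1| * ‖k w‖
        ≤ β * (‖w‖ + 2 * ‖w‖ ^ (-(3 / 4) : ℝ)) * ‖k w‖ := by gcongr
      _ = β * (‖w‖ * ‖k w‖ + 2 * (‖w‖ ^ (-(3 / 4) : ℝ) * ‖k w‖)) := by ring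
      _ ≤ β * (R * G (x - R • w) + 2 * (2 * (R * G (x - R • w)) + 8 * C * W w)) := by gcongr
      _ = B w := by rw [hB]; ring
  have hdiff : Integrable fun w => (‖w‖ ^ (-β) - 1) * k w := by
    refine hBi.mono' (AEStronglyMeasurable.mul ?_ hki.aestronglyMeasurable) hbound
    exact Measurable.aestronglyMeasurable (by fun_prop)
  have hsplit : ∫ w, ‖w‖ ^ (-β) * k w = (∫ w, (‖w‖ ^ (-β) - 1) * k w) + 1 := by
    have h2 := integral_add hdiff hki
    rw [hk1] at h2
    rw [← h2]
    congr 1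
    ext w
    ring
  have hle := (norm_integral_le_of_norm_le hBi hbound).trans_eq hBint
  rw [Real.norm_eq_abs] at hle
  rw [hsplit]
  linarith [neg_abs_le (∫ w, (‖w‖ ^ (-β) - 1) * k w)]

/-- Substituting y = (R/a) w, a = t^(-1/4), homogeneity of |y|^(-β) releases a positive factor. R is
free, to be chosen as max(1, |ax|). -/
lemma evolution_norm_rpow_eq {β : ℝ} (x : Space 1) {t : ℝ} (ht : 0 < t) {R : ℝ} (hR : 0 < R) :
    evolution (fun y : Space 1 => ‖y‖ ^ (-β)) x t = (R / invScale t) ^ (-β) *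
      ∫ w : Space 1, ‖w‖ ^ (-β) * (R * kernel 1 (invScale t • x - R • w)) := by
  have ha := invScale_pos ht
  have hb : 0 < R / invScale t := by positivity
  have h := Measure.integral_comp_smul volume
    (fun y : Space 1 => ‖y‖ ^ (-β) * kernel 1 (invScale t • (x - y))) (R / invScale t)
  rw [finrank_euclideanSpace_fin, pow_one, abs_of_pos (by positivity), smul_eq_mul,
    eq_inv_mul_iff_mul_eq₀ hb.ne'] at h
  simp only [evolution, scaledConv, smul_eq_mul, pow_one]
  rw [← h, ← integral_const_mul, ← integral_const_mul, ← integral_const_mul]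
  congr 1
  ext w
  rw [norm_smul, Real.norm_of_nonneg hb.le, Real.mul_rpow hb.le (norm_nonneg w), smul_sub,
    smul_smul, mul_div_cancel₀ _ ha.ne']
  field_simp

theorem exists_pos_solution_norm_rpow :
    ∃ β₀ : ℝ, 0 < β₀ ∧ ∀ β : ℝ, 0 < β → β < β₀ →
      SolvesCauchy (fun x : Space 1 => ‖x‖ ^ (-β)) (solution 1 (fun x => ‖x‖ ^ (-β))) ∧
      ∀ x t, 0 < t → 0 < solution 1 (fun x => ‖x‖ ^ (-β)) x t := by
  obtain ⟨β₀, h0, h1, h⟩ := exists_integral_norm_rpow_mul_kernel_pos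
  refine ⟨β₀, h0, fun β hβ hβ₀ =>
    ⟨(weightedIntegrable_norm_rpow_neg hβ (by linarith)).solvesCauchy_solution, fun x t ht => ?_⟩⟩
  have ha := invScale_pos ht
  rw [solution_eq_evolution _ x ht,
    evolution_norm_rpow_eq x ht (R := max 1 ‖invScale t • x‖) (by positivity)]
  exact mul_pos (by positivity) (h β hβ hβ₀ _)

end BiharmonicHeat

open BiharmonicHeat in
theorem mainTheorem3 :
    (∀ (n : ℕ), 1 ≤ n → ∀ u₀ : Space n → ℝ, (∀ᵐ x, 0 < u₀ x) →
      Integrable (fun x => (1 + ‖x‖ ^ 4) * u₀ x) →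
        SolvesCauchy u₀ (solution n u₀) ∧
        ∃ T : ℝ, 0 < T ∧ ∀ t : ℝ, T < t →
          (∃ x, 0 < solution n u₀ x t) ∧ (∃ x, solution n u₀ x t < 0)) ∧
    (∃ β₀ : ℝ, 0 < β₀ ∧ ∀ β : ℝ, 0 < β → β < β₀ →
        SolvesCauchy (fun x : Space 1 => ‖x‖ ^ (-β)) (solution 1 (fun x => ‖x‖ ^ (-β))) ∧
        ∀ᵐ p : Space 1 × ℝ ∂(volume.restrict {p | 0 < p.2}),
          0 < solution 1 (fun x => ‖x‖ ^ (-β)) p.1 p.2) := by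
  refine ⟨fun n hn u₀ hpos h => solvesCauchy_and_changes_sign hn hpos h, ?_⟩
  obtain ⟨β₀, h0, h⟩ := exists_pos_solution_norm_rpow
  refine ⟨β₀, h0, fun β hβ hβ₀ => ⟨(h β hβ hβ₀).1, ?_⟩⟩
  refine (ae_restrict_iff' (measurableSet_lt measurable_const measurable_snd)).2 ?_
  exact Eventually.of_forall fun p hp => (h β hβ hβ₀).2 p.1 p.2 hp
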